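/- **Notation.** Let $n\ge 2$. Let $\mathscr S_0(\mathbb R^n)$ be the space of complex Schwartz functions all of whose moments $\int \phi(x)x^{\gamma}\,dx$ vanish, with the topology induced by $\mathscr S(\mathbb R^n)$, and let $\mathscr S_0'=\mathscr S'/\mathcal P$ be its dual (tempered distributions modulo polynomials). Fix any smooth $\phi_0:\mathbb R^n\to[0,\infty)$ that is positive exactly on $\{1/2<|\xi|<2\}$, put $\phi_j(\xi)=\phi_0(2^{-j}\xi)$, $\widehat{\Psi_j}=\phi_j/\sum_{k\in\mathbb Z}\phi_k$ (read as $0$ at $\xi=0$) and $\Delta_jf=\Psi_j*f$ for $j\in\mathbb Z$. For $s\in\mathbb R$ and $1\le p,q\le\infty$, $\dot B^{s}_{p,q}(\mathbb R^n)$ is the set of $f\in\mathscr S_0'$ with $\big(\sum_{j\in\mathbb Z}(2^{js}\|\Delta_jf\|_{L^p})^q\big)^{1/q}<\infty$ (with $\sup_j 2^{js}\|\Delta_jf\|_{L^p}<\infty$ if $q=\infty$). For $\beta\in(1/2,1)$ and $\alpha<\beta$, $Q_\alpha^\beta(\mathbb R^n)$ is the set of measurable $F:\mathbb R^n\to\mathbb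 C$ with $$\sup_I\Big(l(I)^{2(\alpha+\beta-1)-n}\int_I\int_I\frac{|F(x)-F(y)|^2}{|x-y|^{n+2(\alpha-\beta+1)}}\,dx\,dy\Big)^{1/2}<\infty,$$ the supremum being over all cubes $I$ with edges parallel to the coordinate axes, of edge length $l(I)$. An inclusion $\dot B^{s}_{p,q}(\mathbb R^n)\subseteq Q_\alpha^\beta(\mathbb R^n)$ means that every $f\in\dot B^s_{p,q}(\mathbb R^n)$ has a representative in $Q_\alpha^\beta(\mathbb R^n)$: there is $F\in Q_\alpha^\beta(\mathbb R^n)$ such that, for all $\phi\in\mathscr S_0$, $F\phi$ is integrable and $\langle f,\phi\rangle=\int F\phi\,dx$. **Theorem.** Let $n\ge2$ and $\max\{1/2,\alpha\}<\beta<1$. (i) If $1\le q\le2$ and $\alpha+\beta-1>0$, then $\dot B^{\alpha-\beta+1}_{n/(\alpha+\beta-1),\,q}(\mathbb R^n)\subseteq Q_\alpha^\beta(\mathbb R^n)$. (ii) If $1\le q\le\infty$, $\gamma_1>\alpha-\beta+1$, $0<\gamma_2\le n$ and $\gamma_1-\gamma_2=2-2\beta$, then $\dot B^{\gamma_1}_{n/\gamma_2,\,q}(\mathbb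 R^n)\subseteq Q_\alpha^\beta(\mathbb R^n)$. -/

import Mathlib

open MeasureTheory SchwartzMap FourierTransform Filter Topology
open scoped ENNReal ContDiff

/-- `ℝⁿ` with its Euclidean norm and Lebesgue measure. -/
abbrev Rn (n : ℕ) : Type := EuclideanSpace ℝ (Fin n)

/-! ### The test space `𝓢₀` and its dual -/

/-- `𝓢₀(ℝⁿ)`: the complex Schwartz functions all of whose moments
`∫ φ(x) x₁^{γ₁} ⋯ xₙ^{γₙ} dx` vanish. It carries the topology induced by the Schwartz space. -/
noncomputable def schwartzZero (n : ℕ) : Submodule ℂ 𝓢(Rn n, ℂ) where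
  carrier := {φ | ∀ γ : Fin n → ℕ, ∫ x : Rn n, φ x * ∏ i, (x i : ℂ) ^ γ i = 0}
  zero_mem' := by intro γ; simp
  add_mem' := by
    intro φ ψ hφ hψ γ
    have key : ∀ θ : 𝓢(Rn n, ℂ), Integrable (fun x : Rn n => θ x * ∏ i, (x i : ℂ) ^ γ i) := by
      intro θ
      have hg : (fun x : Rn n => ∏ i, (x i : ℂ) ^ γ i).HasTemperateGrowth := by
        have h1 : ∀ i : Fin n, (fun x : Rn n => (x i : ℂ) ^ γ i).HasTemperateGrowth := by
          intro i
          exact ((Complex.ofRealCLM ∘L (EuclideanSpace.proj i : Rn n →L[ℝ] ℝ)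
            ).hasTemperateGrowth).pow (γ i)
        classical
        have h2 : ∀ s : Finset (Fin n),
            (fun x : Rn n => ∏ i ∈ s, (x i : ℂ) ^ γ i).HasTemperateGrowth := by
          intro s
          induction s using Finset.induction_on with
          | empty => simp
          | insert a s ha ih => simp only [Finset.prod_insert ha]; exact (h1 a).mul ih
        exact h2 Finset.univ
      have := (smulLeftCLM ℂ (fun x : Rn n => ∏ i, (x i : ℂ) ^ γ i) θ).integrable
        (μ := (volume : Measure (Rn n)))
      rw [smulLeftCLM_apply hg] at this
      simpa [mul_comm] using this
    simp only [_root_.add_apply, add_mul]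
    rw [integral_add (key φ) (key ψ), hφ γ, hψ γ, add_zero]
  smul_mem' := by
    intro c φ hφ γ
    simp only [_root_.smul_apply, smul_eq_mul, mul_assoc]
    rw [integral_const_mul, hφ γ, mul_zero]

/-- `𝓢₀'(ℝⁿ)`: the topological dual of `𝓢₀(ℝⁿ)`, i.e. tempered distributions modulo
polynomials. -/
abbrev SchwartzZeroDual (n : ℕ) : Type := schwartzZero n →L[ℂ] ℂ

/-! ### Littlewood–Paley pieces -/

/-- A smooth function `φ₀` on `ℝⁿ` that is positive on the annulus `1/2 < |ξ| < 2` and vanishes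
outside of it. -/
structure AnnulusBump (n : ℕ) where
  toFun : Rn n → ℝ
  smooth : ContDiff ℝ ∞ toFun
  pos : ∀ ξ, 1 / 2 < ‖ξ‖ → ‖ξ‖ < 2 → 0 < toFun ξ
  zero_of_le : ∀ ξ, ‖ξ‖ ≤ 1 / 2 → toFun ξ = 0
  zero_of_ge : ∀ ξ, 2 ≤ ‖ξ‖ → toFun ξ = 0

/-- Such functions exist. -/
instance (n : ℕ) : Nonempty (AnnulusBump n) := by
  refine ⟨⟨fun ξ => expNegInvGlue (‖ξ‖ ^ 2 - 1 / 4) * expNegInvGlue (4 - ‖ξ‖ ^ 2), ?_, ?_, ?_, ?_⟩⟩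
  · have h : ContDiff ℝ ∞ (fun ξ : Rn n => ‖ξ‖ ^ 2) := contDiff_norm_sq ℝ
    exact (expNegInvGlue.contDiff.comp (h.sub contDiff_const)).mul
      (expNegInvGlue.contDiff.comp (contDiff_const.sub h))
  · intro ξ h1 h2
    exact mul_pos (expNegInvGlue.pos_of_pos (by nlinarith))
      (expNegInvGlue.pos_of_pos (by nlinarith [norm_nonneg ξ]))
  · intro ξ h
    rw [expNegInvGlue.zero_of_nonpos (by nlinarith [norm_nonneg ξ]), zero_mul]
  · intro ξ h
    rw [expNegInvGlue.zero_of_nonpos (x := 4 - ‖ξ‖ ^ 2) (by nlinarith), mul_zero]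

namespace AnnulusBump

variable {n : ℕ}

/-- `φ_j(ξ) = φ₀(2^{-j} ξ)`. -/
noncomputable def dil (φ₀ : AnnulusBump n) (j : ℤ) (ξ : Rn n) : ℝ :=
  φ₀.toFun ((2 : ℝ) ^ (-j) • ξ)

/-- `φ_j(ξ) / ∑_k φ_k(ξ)`, as a complex-valued function; this is the Fourier transform of `Ψ_j`. -/
noncomputable def symbolFun (φ₀ : AnnulusBump n) (j : ℤ) (ξ : Rn n) : ℂ :=
  ((φ₀.dil j ξ / ∑' k : ℤ, φ₀.dil k ξ : ℝ) : ℂ)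

theorem norm_dil_arg (j : ℤ) (ξ : Rn n) : ‖(2 : ℝ) ^ (-j) • ξ‖ = ‖ξ‖ / (2 : ℝ) ^ j := by
  rw [norm_smul, Real.norm_of_nonneg (by positivity), zpow_neg, div_eq_inv_mul]

theorem dil_pos (φ₀ : AnnulusBump n) {j : ℤ} {ξ : Rn n} (h1 : (2 : ℝ) ^ (j - 1) < ‖ξ‖)
    (h2 : ‖ξ‖ < (2 : ℝ) ^ (j + 1)) : 0 < φ₀.dil j ξ := by
  have hj : (0 : ℝ) < (2 : ℝ) ^ j := by positivity
  rw [zpow_sub_one₀ two_ne_zero] at h1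
  rw [zpow_add_one₀ two_ne_zero] at h2
  apply φ₀.pos
  · rw [norm_dil_arg, lt_div_iff₀ hj]; linarith
  · rw [norm_dil_arg, div_lt_iff₀ hj]; linarith

theorem dil_zero_of_le (φ₀ : AnnulusBump n) {j : ℤ} {ξ : Rn n} (h : ‖ξ‖ ≤ (2 : ℝ) ^ (j - 1)) :
    φ₀.dil j ξ = 0 := by
  have hj : (0 : ℝ) < (2 : ℝ) ^ j := by positivity
  rw [zpow_sub_one₀ two_ne_zero] at h
  apply φ₀.zero_of_le
  rw [norm_dil_arg, div_le_iff₀ hj]; linarith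

theorem dil_zero_of_ge (φ₀ : AnnulusBump n) {j : ℤ} {ξ : Rn n} (h : (2 : ℝ) ^ (j + 1) ≤ ‖ξ‖) :
    φ₀.dil j ξ = 0 := by
  have hj : (0 : ℝ) < (2 : ℝ) ^ j := by positivity
  rw [zpow_add_one₀ two_ne_zero] at h
  apply φ₀.zero_of_ge
  rw [norm_dil_arg, le_div_iff₀ hj]; linarith

theorem dil_nonneg (φ₀ : AnnulusBump n) (j : ℤ) (ξ : Rn n) : 0 ≤ φ₀.dil j ξ := by
  by_cases h1 : (2 : ℝ) ^ (j - 1) < ‖ξ‖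
  · by_cases h2 : ‖ξ‖ < (2 : ℝ) ^ (j + 1)
    · exact (φ₀.dil_pos h1 h2).le
    · exact (φ₀.dil_zero_of_ge (not_lt.mp h2)).ge
  · exact (φ₀.dil_zero_of_le (not_lt.mp h1)).ge

theorem contDiff_dil (φ₀ : AnnulusBump n) (j : ℤ) : ContDiff ℝ ∞ (φ₀.dil j) :=
  φ₀.smooth.comp (contDiff_const_smul _)

theorem symbolFun_zero_of_le (φ₀ : AnnulusBump n) {j : ℤ} {ξ : Rn n}
    (h : ‖ξ‖ ≤ (2 : ℝ) ^ (j - 1)) : φ₀.symbolFun j ξ = 0 := by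
  simp [symbolFun, φ₀.dil_zero_of_le h]

theorem contDiff_symbolFun (φ₀ : AnnulusBump n) (j : ℤ) : ContDiff ℝ ∞ (φ₀.symbolFun j) := by
  rw [contDiff_iff_contDiffAt]
  intro ξ₀
  by_cases h0 : ξ₀ = 0
  · subst h0
    have : φ₀.symbolFun j =ᶠ[𝓝 0] fun _ => (0 : ℂ) := by
      filter_upwards [Metric.ball_mem_nhds (0 : Rn n)
        (show (0 : ℝ) < (2 : ℝ) ^ (j - 1) by positivity)] with ξ hξ
      exact φ₀.symbolFun_zero_of_le (mem_ball_zero_iff.mp hξ).le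
    exact contDiffAt_const.congr_of_eventuallyEq this
  · obtain ⟨m, hm1, hm2⟩ := exists_mem_Ico_zpow (norm_pos_iff.mpr h0) (one_lt_two : (1 : ℝ) < 2)
    have hlt : (2 : ℝ) ^ (m - 1) < ‖ξ₀‖ :=
      lt_of_lt_of_le (zpow_lt_zpow_right₀ one_lt_two (by omega)) hm1
    have hev : ∀ᶠ ξ in 𝓝 ξ₀, ∑' k : ℤ, φ₀.dil k ξ = ∑ k ∈ Finset.Icc (m - 2) (m + 2), φ₀.dil k ξ := by
      filter_upwards [continuous_norm.continuousAt.eventually (eventually_gt_nhds hlt),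
        continuous_norm.continuousAt.eventually (eventually_lt_nhds hm2)] with ξ h1 h2
      apply tsum_eq_sum
      intro k hk
      rw [Finset.mem_Icc, not_and_or, not_le, not_le] at hk
      rcases hk with hk | hk
      · exact φ₀.dil_zero_of_ge
          ((zpow_le_zpow_right₀ one_le_two (by omega : k + 1 ≤ m - 1)).trans h1.le)
      · exact φ₀.dil_zero_of_le
          (h2.le.trans (zpow_le_zpow_right₀ one_le_two (by omega : m + 1 ≤ k - 1)))
    have hpos : (∑ k ∈ Finset.Icc (m - 2) (m + 2), φ₀.dil k ξ₀) ≠ 0 := by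
      apply ne_of_gt
      apply Finset.sum_pos' (fun k _ => φ₀.dil_nonneg k ξ₀)
      exact ⟨m, by simp, φ₀.dil_pos hlt hm2⟩
    have hsum : ContDiffAt ℝ ∞ (fun ξ => ∑ k ∈ Finset.Icc (m - 2) (m + 2), φ₀.dil k ξ) ξ₀ :=
      ContDiffAt.sum fun k _ => (φ₀.contDiff_dil k).contDiffAt
    have hdiv := Complex.ofRealCLM.contDiff.contDiffAt.comp ξ₀
      ((φ₀.contDiff_dil j).contDiffAt.div hsum hpos)
    refine hdiv.congr_of_eventuallyEq ?_
    filter_upwards [hev] with ξ hξ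
    simp [symbolFun, hξ]

theorem hasCompactSupport_symbolFun (φ₀ : AnnulusBump n) (j : ℤ) :
    HasCompactSupport (φ₀.symbolFun j) := by
  refine HasCompactSupport.intro (isCompact_closedBall (0 : Rn n) ((2 : ℝ) ^ (j + 1))) ?_
  intro ξ hξ
  rw [mem_closedBall_zero_iff, not_le] at hξ
  simp [symbolFun, φ₀.dil_zero_of_ge hξ.le]

/-- The Schwartz function `φ_j / ∑_k φ_k`. -/
noncomputable def symbol (φ₀ : AnnulusBump n) (j : ℤ) : 𝓢(Rn n, ℂ) :=
  (φ₀.hasCompactSupport_symbolFun j).toSchwartzMap (φ₀.contDiff_symbolFun j)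

/-- `Ψ_j`: the Schwartz function with Fourier transform `φ_j / ∑_k φ_k`. -/
noncomputable def psi (φ₀ : AnnulusBump n) (j : ℤ) : 𝓢(Rn n, ℂ) := 𝓕⁻ (φ₀.symbol j)

end AnnulusBump

/-- The Schwartz function `y ↦ ψ(x - y)`. -/
noncomputable def reflectTranslate {n : ℕ} (ψ : 𝓢(Rn n, ℂ)) (x : Rn n) : 𝓢(Rn n, ℂ) :=
  compCLMOfAntilipschitz (K := 1) ℂ (g := fun y : Rn n => x - y) (by fun_prop)
    (fun _ _ => by simp [edist_dist, dist_eq_norm, norm_sub_rev]) ψ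

theorem reflectTranslate_apply {n : ℕ} (ψ : 𝓢(Rn n, ℂ)) (x y : Rn n) :
    reflectTranslate ψ x y = ψ (x - y) := rfl

theorem mem_schwartzZero_of_fourier_eventually_zero {n : ℕ} (φ : 𝓢(Rn n, ℂ))
    (h : ∀ᶠ ξ in 𝓝 (0 : Rn n), (𝓕 φ) ξ = 0) : φ ∈ schwartzZero n := by
  have key : ∀ (p : MvPolynomial (Fin n) ℂ) (φ : 𝓢(Rn n, ℂ)),
      (∀ᶠ ξ in 𝓝 (0 : Rn n), (𝓕 φ) ξ = 0) → ∃ ψ : 𝓢(Rn n, ℂ),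
        (∀ᶠ ξ in 𝓝 (0 : Rn n), (𝓕 ψ) ξ = 0) ∧
        ∀ y : Rn n, ψ y = φ y * MvPolynomial.eval (fun i => (y i : ℂ)) p := by
    intro p
    induction p using MvPolynomial.induction_on with
    | C a =>
      intro φ h
      refine ⟨a • φ, ?_, fun y => by simp [mul_comm]⟩
      filter_upwards [h] with ξ hξ
      rw [FourierTransform.fourier_smul]
      simp [hξ]
    | add p q hp hq =>
      intro φ h
      obtain ⟨ψ, h1, h2⟩ := hp φ h
      obtain ⟨θ, h3, h4⟩ := hq φ h
      refine ⟨ψ + θ, ?_, fun y => by simp [h2, h4, mul_add]⟩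
      filter_upwards [h1, h3] with ξ hξ hξ'
      rw [FourierTransform.fourier_add]
      simp [hξ, hξ']
    | mul_X p i hp =>
      intro φ h
      obtain ⟨ψ, h1, h2⟩ := hp φ h
      set m : Rn n := EuclideanSpace.single i (1 : ℝ) with hm
      have hg : (fun y : Rn n => (inner ℝ y m : ℝ)).HasTemperateGrowth := by fun_prop
      refine ⟨smulLeftCLM ℂ (fun y : Rn n => (inner ℝ y m : ℝ)) ψ, ?_, ?_⟩
      · have e := lineDerivOp_fourier_eq ψ m
        rw [FourierTransform.fourier_smul] at e
        filter_upwards [eventually_eventually_nhds.mpr h1] with ξ hξ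
        have e1 := congrArg (fun f : 𝓢(Rn n, ℂ) => f ξ) e
        have e2 : (LineDeriv.lineDerivOp m (𝓕 ψ) : 𝓢(Rn n, ℂ)) ξ = 0 := by
          rw [SchwartzMap.lineDerivOp_apply_eq_fderiv]
          have : (⇑(𝓕 ψ : 𝓢(Rn n, ℂ)) : Rn n → ℂ) =ᶠ[𝓝 ξ] fun _ => 0 := hξ
          rw [this.fderiv_eq]
          simp
        simp only [e2, _root_.smul_apply, smul_eq_mul] at e1
        rcases mul_eq_zero.mp e1.symm with h0 | h0
        · exfalso
          simp [Real.pi_ne_zero] at h0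
        · exact h0
      · intro y
        rw [smulLeftCLM_apply_apply hg, h2]
        simp [hm, EuclideanSpace.inner_single_right]
        ring
  intro γ
  obtain ⟨ψ, h1, h2⟩ := key (MvPolynomial.monomial (Finsupp.equivFunOnFinite.symm γ) 1) φ h
  have h3 : (𝓕 ψ) (0 : Rn n) = 0 := h1.self_of_nhds
  rw [fourier_coe, Real.fourier_eq] at h3
  simpa [h2, MvPolynomial.eval_monomial, Finsupp.prod_fintype] using h3

theorem fourier_reflectTranslate {n : ℕ} (ψ : 𝓢(Rn n, ℂ)) (x ξ : Rn n) :
    (𝓕 (reflectTranslate ψ x)) ξ = Real.fourierChar (-inner ℝ x ξ) • (𝓕 ψ) (-ξ) := by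
  rw [fourier_coe, fourier_coe, Real.fourier_eq, Real.fourier_eq,
    ← integral_sub_left_eq_self _ _ x, Circle.smul_def, ← integral_smul]
  congr 1
  ext y
  rw [← Circle.smul_def, smul_smul, ← AddChar.map_add_eq_mul]
  rw [reflectTranslate_apply, sub_sub_cancel]
  congr 2
  simp [inner_sub_left]; ring

theorem reflectTranslate_psi_mem {n : ℕ} (φ₀ : AnnulusBump n) (j : ℤ) (x : Rn n) :
    reflectTranslate (φ₀.psi j) x ∈ schwartzZero n := by
  apply mem_schwartzZero_of_fourier_eventually_zero
  filter_upwards [Metric.ball_mem_nhds (0 : Rn n)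
    (show (0 : ℝ) < (2 : ℝ) ^ (j - 1) by positivity)] with ξ hξ
  rw [fourier_reflectTranslate, AnnulusBump.psi, FourierTransform.fourier_fourierInv_eq]
  have : φ₀.symbol j (-ξ) = 0 :=
    φ₀.symbolFun_zero_of_le (by rw [norm_neg]; exact (mem_ball_zero_iff.mp hξ).le)
  rw [this, smul_zero]

/-- `Δ_j f = Ψ_j * f` for `f ∈ 𝓢₀'`: the function `x ↦ ⟨f, Ψ_j(x - ·)⟩`. -/
noncomputable def lpPiece {n : ℕ} (φ₀ : AnnulusBump n) (j : ℤ) (f : SchwartzZeroDual n)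
    (x : Rn n) : ℂ :=
  f ⟨reflectTranslate (φ₀.psi j) x, reflectTranslate_psi_mem φ₀ j x⟩

/-! ### Homogeneous Besov spaces -/

/-- The homogeneous Besov norm `‖f‖_{Ḃ^s_{p,q}}`, with values in `[0, ∞]`. -/
noncomputable def besovNorm {n : ℕ} (φ₀ : AnnulusBump n) (s : ℝ) (p q : ℝ≥0∞)
    (f : SchwartzZeroDual n) : ℝ≥0∞ :=
  if q = ⊤ then
    ⨆ j : ℤ, ENNReal.ofReal ((2 : ℝ) ^ (j * s : ℝ)) * eLpNorm (lpPiece φ₀ j f) p volume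
  else
    (∑' j : ℤ, (ENNReal.ofReal ((2 : ℝ) ^ (j * s : ℝ)) *
      eLpNorm (lpPiece φ₀ j f) p volume) ^ q.toReal) ^ (1 / q.toReal)

/-- The homogeneous Besov space `Ḃ^s_{p,q}(ℝⁿ)`, for `1 ≤ p, q ≤ ∞`. -/
def besovSpace {n : ℕ} (φ₀ : AnnulusBump n) (s : ℝ) (p q : ℝ≥0∞) : Set (SchwartzZeroDual n) :=
  {f | besovNorm φ₀ s p q f < ⊤}

/-! ### The spaces `Q_α^β` -/

/-- The closed cube with edges parallel to the axes, lowest corner `a` and edge length `l`. -/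
def cube {n : ℕ} (a : Rn n) (l : ℝ) : Set (Rn n) := {x | ∀ i, a i ≤ x i ∧ x i ≤ a i + l}

/-- The norm
`sup_I (l(I)^{2(α+β-1)-n} ∫_I ∫_I |F(x)-F(y)|² / |x-y|^{n+2(α-β+1)} dx dy)^{1/2}`, with values
in `[0, ∞]`. -/
noncomputable def qNorm {n : ℕ} (α β : ℝ) (F : Rn n → ℂ) : ℝ≥0∞ :=
  ⨆ (a : Rn n) (l : ℝ) (_ : 0 < l),
    (ENNReal.ofReal (l ^ (2 * (α + β - 1) - n)) *
      ∫⁻ x in cube a l, ∫⁻ y in cube a l,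
        ‖F x - F y‖ₑ ^ (2 : ℝ) / ‖x - y‖ₑ ^ (n + 2 * (α - β + 1))) ^ (1 / 2 : ℝ)

/-- `Q_α^β(ℝⁿ)`: the Lebesgue measurable complex-valued functions with finite `Q_α^β` norm. -/
def qSpace (n : ℕ) (α β : ℝ) : Set (Rn n → ℂ) :=
  {F | AEStronglyMeasurable F volume ∧ qNorm α β F < ⊤}

/-- The function `F` is a representative of `f ∈ 𝓢₀'`: integration against `F` is absolutely
convergent on `𝓢₀` and equals `f` there. -/
def IsRepresentative {n : ℕ} (F : Rn n → ℂ) (f : SchwartzZeroDual n) : Prop :=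
  ∀ φ : schwartzZero n, Integrable (fun x => F x * φ.1 x) ∧ f φ = ∫ x, F x * φ.1 x

/-- `Q_α^β(ℝⁿ)` as a subset of `𝓢₀'(ℝⁿ)`: the classes modulo polynomials which contain a function
in `Q_α^β(ℝⁿ)`. -/
def qClasses (n : ℕ) (α β : ℝ) : Set (SchwartzZeroDual n) :=
  {f | ∃ F ∈ qSpace n α β, IsRepresentative F f}

/-! Put `σ = 2 - 2β`, which lies in `(0, 1)`, and `s = α - β + 1 < 1`. The representative is `F = ∑ⱼ
(Δⱼf - Δⱼf(0))`: at low frequencies only increments are summable, and the subtracted constants are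
invisible to `𝓢₀`. Both inclusions reduce to `mem_qClasses_of_lpPiece`, where `p ≥ 2`, `0 < γ < 1`,
`γ - n/p = σ` and `bⱼ = 2^{jγ} ‖Δⱼf‖_p` is bounded.

Each `Δⱼf` is reproduced by convolution with a dilate of one fixed Schwartz kernel. Hence
(`exists_bernstein_const`) its increment by `h` is at most a constant times `min(1, 2ʲ|h|) 2^{-jσ}
bⱼ` in sup norm, and `min(1, 2ʲ|h|) 2^{-jγ} bⱼ` in `L^p`. The first bound sums to `|h|^σ`, so `F`
converges, is Hölder continuous and represents `f`. The second controls `ω(h) = ‖F(· + h) - F‖_p`.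
In the double integral over a cube of edge `l`, the substitution `y = x + h` and Hölder's inequality
in `x` leave `∫ ω(h)² |h|^{-n-2s} dh` over `|h| ≲ l`. If this is `O(l^{2(γ-s)})`, all powers of `l`
cancel, by `γ - n/p = σ`.

For `s < γ`, boundedness of `b` gives `ω(h) ≲ |h|^γ`, which suffices. This yields (ii): Bernstein's
inequality trades the smoothness `γ₁` for some `γ` strictly between `max(s, σ)` and `min(1, γ₁)`
without changing the difference `γ - n/p`, and `q` plays no role. For `s = γ`, which is (i), that
bound would diverge logarithmically. There a Cauchy–Schwarz inequality with weights `min(1, 2ʲ|h|)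
(2ʲ|h|)^{-γ}` and the dilation invariance of `|h|^{-n} dh` bound the integral by `∑ bⱼ²`, finite
since `q ≤ 2`.

It remains to handle `Δⱼf` for an abstract functional `f`. Being bounded by finitely many seminorms,
`f` factors through a Banach space (Hahn–Banach), where it commutes with Bochner integrals; thus `∫
φ Δⱼf` is `f` applied to a convolution. These convolutions sum to `φ` in `𝓢₀` (`hasSum_lpTest`),
because the Fourier transform of `φ` vanishes to infinite order at the origin. -/

open scoped LineDeriv BoundedContinuousFunction

/-! ### Convolution of Schwartz functions and functionals on `𝓢₀` -/

/-- The convolution of two complex Schwartz functions. -/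
noncomputable abbrev schwartzConv {n : ℕ} (φ η : 𝓢(Rn n, ℂ)) : 𝓢(Rn n, ℂ) :=
  SchwartzMap.convolution (ContinuousLinearMap.mul ℂ ℂ) φ η

theorem schwartzConv_apply {n : ℕ} (φ η : 𝓢(Rn n, ℂ)) (y : Rn n) :
    schwartzConv φ η y = ∫ x, φ x * η (y - x) := by
  rw [schwartzConv, SchwartzMap.convolution_apply]
  rfl

theorem fourier_schwartzConv_apply {n : ℕ} (φ η : 𝓢(Rn n, ℂ)) (ξ : Rn n) :
    𝓕 (schwartzConv φ η) ξ = 𝓕 φ ξ * 𝓕 η ξ := by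
  rw [schwartzConv, SchwartzMap.fourier_convolution]
  rfl

/-- On the Fourier side a derivative is multiplication by a linear form, which either factor can
absorb. Putting all derivatives on `η` makes a derivative of the convolution a superposition of
translated derivatives of `η`. -/
theorem lineDerivOp_schwartzConv {n : ℕ} (φ η : 𝓢(Rn n, ℂ)) (m : Rn n) :
    ∂_{m} (schwartzConv φ η) = schwartzConv φ (∂_{m} η) := by
  have h : 𝓕 (∂_{m} (schwartzConv φ η)) = 𝓕 (schwartzConv φ (∂_{m} η)) := by
    ext ξ
    have hg : (fun y : Rn n => (inner ℝ y m : ℝ)).HasTemperateGrowth := by fun_prop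
    rw [fourier_schwartzConv_apply, fourier_lineDerivOp_eq, fourier_lineDerivOp_eq]
    simp only [_root_.smul_apply, smulLeftCLM_apply_apply hg, fourier_schwartzConv_apply,
      smul_eq_mul, Complex.real_smul]
    ring
  have := congrArg (fun f => 𝓕⁻ f) h
  simpa using this

theorem iteratedLineDerivOp_schwartzConv {n : ℕ} (φ η : 𝓢(Rn n, ℂ)) {l : ℕ} (m : Fin l → Rn n) :
    ∂^{m} (schwartzConv φ η) = schwartzConv φ (∂^{m} η) := by
  induction l with
  | zero => simp
  | succ l ih =>
    rw [LineDeriv.iteratedLineDerivOp_succ_left, ih, lineDerivOp_schwartzConv,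
      ← LineDeriv.iteratedLineDerivOp_succ_left]

/-- Bounded continuous functions with values in the `l`-linear maps. -/
def BoundedForms (n l : ℕ) : Type := Rn n →ᵇ (Rn n [×l]→L[ℝ] ℂ)

noncomputable instance (n l : ℕ) : NormedAddCommGroup (BoundedForms n l) :=
  inferInstanceAs (NormedAddCommGroup (Rn n →ᵇ (Rn n [×l]→L[ℝ] ℂ)))

noncomputable instance (n l : ℕ) : NormedSpace ℂ (BoundedForms n l) :=
  inferInstanceAs (NormedSpace ℂ (Rn n →ᵇ (Rn n [×l]→L[ℝ] ℂ)))

instance (n l : ℕ) : CompleteSpace (BoundedForms n l) :=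
  inferInstanceAs (CompleteSpace (Rn n →ᵇ (Rn n [×l]→L[ℝ] ℂ)))

/-- Evaluation of a bounded family of `l`-linear maps at a point and a tuple of vectors. -/
noncomputable def BoundedForms.eval {n l : ℕ} (y : Rn n) (m : Fin l → Rn n) :
    BoundedForms n l →L[ℝ] ℂ :=
  (ContinuousMultilinearMap.apply ℝ (fun _ : Fin l => Rn n) ℂ m).comp
    (BoundedContinuousFunction.evalCLM ℝ y)

theorem BoundedForms.ext_eval {n l : ℕ} {u v : BoundedForms n l}
    (h : ∀ y m, BoundedForms.eval y m u = BoundedForms.eval y m v) : u = v := by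
  apply BoundedContinuousFunction.ext
  intro y
  ext m
  exact h y m

/-- The underlying bounded continuous function. -/
def BoundedForms.toBCF {n l : ℕ} (u : BoundedForms n l) : Rn n →ᵇ (Rn n [×l]→L[ℝ] ℂ) := u

theorem BoundedForms.norm_le {n l : ℕ} (u : BoundedForms n l) {C : ℝ} (hC : 0 ≤ C) :
    ‖u‖ ≤ C ↔ ∀ y, ‖u.toBCF y‖ ≤ C :=
  BoundedContinuousFunction.norm_le hC

/-- `φ ↦ ‖y‖ᵏ Dˡφ(y)`, as a map to the bounded continuous functions. -/
noncomputable def weightedDeriv {n : ℕ} (k l : ℕ) :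
    𝓢(Rn n, ℂ) →ₗ[ℂ] BoundedForms n l where
  toFun φ := BoundedContinuousFunction.ofNormedAddCommGroup
    (fun y => (‖y‖ ^ k) • iteratedFDeriv ℝ l φ y)
    ((continuous_norm.pow k).smul ((φ.smooth ⊤).continuous_iteratedFDeriv (mod_cast le_top)))
    (SchwartzMap.seminorm ℂ k l φ)
    (fun y => by
      rw [norm_smul, norm_pow, norm_norm]
      exact SchwartzMap.le_seminorm ℂ k l φ y)
  map_add' φ ψ := by
    apply BoundedContinuousFunction.ext
    intro y
    have : iteratedFDeriv ℝ l (⇑(φ + ψ)) y = iteratedFDeriv ℝ l φ y + iteratedFDeriv ℝ l ψ y :=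
      iteratedFDeriv_add_apply (φ.smooth _).contDiffAt (ψ.smooth _).contDiffAt
    change ‖y‖ ^ k • iteratedFDeriv ℝ l (⇑(φ + ψ)) y = ‖y‖ ^ k • iteratedFDeriv ℝ l φ y +
      ‖y‖ ^ k • iteratedFDeriv ℝ l ψ y
    rw [this, smul_add]
  map_smul' c φ := by
    apply BoundedContinuousFunction.ext
    intro y
    have : iteratedFDeriv ℝ l (⇑(c • φ)) y = c • iteratedFDeriv ℝ l φ y :=
      iteratedFDeriv_const_smul_apply (φ.smooth _).contDiffAt
    change ‖y‖ ^ k • iteratedFDeriv ℝ l (⇑(c • φ)) y = c • ‖y‖ ^ k • iteratedFDeriv ℝ l φ y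
    rw [this, smul_comm]

theorem weightedDeriv_apply {n : ℕ} (k l : ℕ) (φ : 𝓢(Rn n, ℂ)) (y : Rn n) :
    (weightedDeriv k l φ).toBCF y =
      (‖y‖ ^ k) • iteratedFDeriv ℝ l φ y := rfl

theorem eval_weightedDeriv {n : ℕ} (k l : ℕ) (φ : 𝓢(Rn n, ℂ)) (y : Rn n) (m : Fin l → Rn n) :
    BoundedForms.eval y m (weightedDeriv k l φ) = ‖y‖ ^ k * iteratedFDeriv ℝ l φ y m := by
  change ‖y‖ ^ k • iteratedFDeriv ℝ l φ y m = _
  rw [Complex.real_smul, Complex.ofReal_pow]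

theorem seminorm_le_norm_weightedDeriv {n : ℕ} (k l : ℕ) (φ : 𝓢(Rn n, ℂ)) :
    SchwartzMap.seminorm ℂ k l φ ≤ ‖weightedDeriv k l φ‖ := by
  refine SchwartzMap.seminorm_le_bound ℂ k l φ (norm_nonneg _) fun y => ?_
  have := ((weightedDeriv k l φ).norm_le (norm_nonneg _)).1 le_rfl y
  rwa [weightedDeriv_apply, norm_smul, norm_pow, norm_norm] at this

theorem norm_weightedDeriv_le {n : ℕ} (k l : ℕ) (φ : 𝓢(Rn n, ℂ)) {C : ℝ} (hC : 0 ≤ C)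
    (h : ∀ y, ‖y‖ ^ k * ‖iteratedFDeriv ℝ l φ y‖ ≤ C) : ‖weightedDeriv k l φ‖ ≤ C := by
  refine (BoundedForms.norm_le _ hC).2 fun y => ?_
  rw [weightedDeriv_apply, norm_smul, norm_pow, norm_norm]
  exact h y

/-- Translation `η ↦ η(· - x)`. -/
noncomputable abbrev schwartzTranslate {n : ℕ} (η : 𝓢(Rn n, ℂ)) (x : Rn n) : 𝓢(Rn n, ℂ) :=
  compSubConstCLM ℂ x η

theorem iteratedFDeriv_translate {n : ℕ} (l : ℕ) (η : 𝓢(Rn n, ℂ)) (x y : Rn n) :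
    iteratedFDeriv ℝ l (schwartzTranslate η x) y = iteratedFDeriv ℝ l η (y - x) :=
  iteratedFDeriv_comp_sub l x y

theorem norm_pow_le_two_pow {n : ℕ} (k : ℕ) (x y : Rn n) :
    ‖y‖ ^ k ≤ 2 ^ k * (‖y - x‖ ^ k + ‖x‖ ^ k) := by
  have h1 : ‖y‖ ≤ ‖y - x‖ + ‖x‖ := by simpa using norm_add_le (y - x) x
  calc ‖y‖ ^ k ≤ (‖y - x‖ + ‖x‖) ^ k := by gcongr
    _ ≤ 2 ^ (k - 1) * (‖y - x‖ ^ k + ‖x‖ ^ k) :=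
        add_pow_le (norm_nonneg _) (norm_nonneg _) k
    _ ≤ _ := by gcongr <;> simp

/-- The weight splits between `y - x` and `x`. The cost of translating is only polynomial in `x`,
which a Schwartz factor absorbs later. -/
theorem weighted_iteratedFDeriv_sub_le {n : ℕ} (k l : ℕ) (η : 𝓢(Rn n, ℂ)) (x y : Rn n) :
    ‖y‖ ^ k * ‖iteratedFDeriv ℝ l η (y - x)‖ ≤
      2 ^ k * (SchwartzMap.seminorm ℂ k l η + ‖x‖ ^ k * SchwartzMap.seminorm ℂ 0 l η) := by
  have h1 := SchwartzMap.le_seminorm ℂ k l η (y - x)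
  have h2 := SchwartzMap.norm_iteratedFDeriv_le_seminorm ℂ η l (y - x)
  have h3 := norm_pow_le_two_pow k x y
  calc _ ≤ 2 ^ k * (‖y - x‖ ^ k + ‖x‖ ^ k) * ‖iteratedFDeriv ℝ l η (y - x)‖ := by gcongr
    _ = 2 ^ k * (‖y - x‖ ^ k * ‖iteratedFDeriv ℝ l η (y - x)‖ +
          ‖x‖ ^ k * ‖iteratedFDeriv ℝ l η (y - x)‖) := by ring
    _ ≤ _ := by gcongr

theorem norm_weightedDeriv_translate_le {n : ℕ} (k l : ℕ) (η : 𝓢(Rn n, ℂ)) (x : Rn n) :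
    ‖weightedDeriv k l (schwartzTranslate η x)‖ ≤
      2 ^ k * (SchwartzMap.seminorm ℂ k l η + ‖x‖ ^ k * SchwartzMap.seminorm ℂ 0 l η) := by
  refine norm_weightedDeriv_le k l _ (by positivity) fun y => ?_
  rw [iteratedFDeriv_translate]
  exact weighted_iteratedFDeriv_sub_le k l η x y

/-- Mean value inequality in the translation parameter. The factor `c` will be a power of `‖y‖`,
which is constant because `y` is fixed. -/
theorem mul_norm_sub_comp_sub_le {V W : Type*} [NormedAddCommGroup V] [NormedSpace ℝ V]
    [NormedAddCommGroup W] [NormedSpace ℝ W] {u : V → W} (hu : Differentiable ℝ u) {c M : ℝ}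
    (hc : 0 ≤ c) {a b : V} (y : V) (hab : ‖b - a‖ ≤ 1)
    (h : ∀ x ∈ Metric.closedBall a 1, c * ‖fderiv ℝ u (y - x)‖ ≤ M) :
    c * ‖u (y - b) - u (y - a)‖ ≤ M * ‖b - a‖ := by
  have hd : ∀ x ∈ Metric.closedBall a 1, HasFDerivWithinAt (fun x => c • u (y - x))
      (c • (fderiv ℝ u (y - x)).comp (-(ContinuousLinearMap.id ℝ V))) (Metric.closedBall a 1) x := by
    intro x _
    refine (HasFDerivAt.hasFDerivWithinAt ?_)
    exact ((hu (y - x)).hasFDerivAt.comp x ((hasFDerivAt_id x).const_sub y)).const_smul c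
  have := (convex_closedBall a 1).norm_image_sub_le_of_norm_hasFDerivWithin_le hd (C := M)
    (fun x hx => by
      rw [norm_smul, Real.norm_of_nonneg hc, ContinuousLinearMap.comp_neg, norm_neg,
        ContinuousLinearMap.comp_id]
      exact h x hx)
    (Metric.mem_closedBall_self zero_le_one) (by rwa [mem_closedBall_iff_norm])
  rwa [← smul_sub, norm_smul, Real.norm_of_nonneg hc] at this

theorem norm_smul_sub_smul {W : Type*} [NormedAddCommGroup W] [NormedSpace ℝ W] {c : ℝ}
    (hc : 0 ≤ c) (u v : W) : ‖c • u - c • v‖ = c * ‖u - v‖ := by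
  rw [← smul_sub, norm_smul, Real.norm_of_nonneg hc]

theorem norm_weightedDeriv_translate_sub_le {n : ℕ} (k l : ℕ) (η : 𝓢(Rn n, ℂ)) {a b : Rn n}
    (hab : ‖b - a‖ ≤ 1) :
    ‖weightedDeriv k l (schwartzTranslate η b) - weightedDeriv k l (schwartzTranslate η a)‖ ≤
      2 ^ k * (SchwartzMap.seminorm ℂ k (l + 1) η +
        (‖a‖ + 1) ^ k * SchwartzMap.seminorm ℂ 0 (l + 1) η) * ‖b - a‖ := by
  refine (BoundedForms.norm_le _ (by positivity)).2 fun y => ?_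
  change ‖(weightedDeriv k l (schwartzTranslate η b)).toBCF y -
    (weightedDeriv k l (schwartzTranslate η a)).toBCF y‖ ≤ _
  rw [weightedDeriv_apply, weightedDeriv_apply, iteratedFDeriv_translate, iteratedFDeriv_translate]
  refine (norm_smul_sub_smul (by positivity) _ _).trans_le ?_
  have h1 : Differentiable ℝ (iteratedFDeriv ℝ l η) :=
    (η.smooth ⊤).differentiable_iteratedFDeriv (mod_cast ENat.natCast_lt_top l)
  refine mul_norm_sub_comp_sub_le h1 (by positivity) y hab fun x hx => ?_
  rw [norm_fderiv_iteratedFDeriv]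
  refine (weighted_iteratedFDeriv_sub_le k (l + 1) η x y).trans ?_
  have : ‖x‖ ≤ ‖a‖ + 1 := norm_le_of_mem_closedBall hx
  gcongr

theorem continuous_weightedDeriv_translate {n : ℕ} (k l : ℕ) (η : 𝓢(Rn n, ℂ)) :
    Continuous fun x => weightedDeriv k l (schwartzTranslate η x) := by
  rw [continuous_iff_continuousAt]
  intro a
  rw [ContinuousAt, tendsto_iff_norm_sub_tendsto_zero]
  set C := 2 ^ k * (SchwartzMap.seminorm ℂ k (l + 1) η +
        (‖a‖ + 1) ^ k * SchwartzMap.seminorm ℂ 0 (l + 1) η) with hC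
  have h0 : Tendsto (fun b : Rn n => C * ‖b - a‖) (𝓝 a) (𝓝 0) := by
    have : Continuous fun b : Rn n => C * ‖b - a‖ := by fun_prop
    simpa using this.tendsto a
  refine squeeze_zero' (Eventually.of_forall fun _ => norm_nonneg _) ?_ h0
  filter_upwards [Metric.closedBall_mem_nhds a one_pos] with b hb
  exact norm_weightedDeriv_translate_sub_le k l η (by rwa [mem_closedBall_iff_norm] at hb)

theorem integrable_smul_weightedDeriv_translate {n : ℕ} (k l : ℕ) (φ η : 𝓢(Rn n, ℂ)) :
    Integrable fun x => φ x • weightedDeriv k l (schwartzTranslate η x) := by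
  have hb : Integrable fun x => ‖φ x‖ * (2 ^ k * (SchwartzMap.seminorm ℂ k l η)) +
      ‖x‖ ^ k * ‖φ x‖ * (2 ^ k * SchwartzMap.seminorm ℂ 0 l η) :=
    (φ.integrable.norm.mul_const _).add ((φ.integrable_pow_mul volume k).mul_const _)
  refine hb.mono' ((φ.continuous.smul
    (continuous_weightedDeriv_translate k l η)).aestronglyMeasurable) (Eventually.of_forall ?_)
  intro x
  rw [norm_smul]
  calc _ ≤ ‖φ x‖ * (2 ^ k * (SchwartzMap.seminorm ℂ k l η +
          ‖x‖ ^ k * SchwartzMap.seminorm ℂ 0 l η)) := by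
        gcongr; exact norm_weightedDeriv_translate_le k l η x
    _ = _ := by ring

/-- The convolution is the superposition of the translates of `η` with density `φ`, as a Bochner
integral in a Banach space. Evaluations are continuous and separate points, so the identity reduces
to the pointwise formula for the convolution. -/
theorem integral_smul_weightedDeriv_translate {n : ℕ} (k l : ℕ) (φ η : 𝓢(Rn n, ℂ)) :
    ∫ x, φ x • weightedDeriv k l (schwartzTranslate η x) = weightedDeriv k l (schwartzConv φ η) := by
  refine BoundedForms.ext_eval fun y m => ?_
  have h1 := (BoundedForms.eval y m).integral_comp_comm
    (integrable_smul_weightedDeriv_translate k l φ η)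
  rw [← h1, eval_weightedDeriv, ← iteratedLineDerivOp_eq_iteratedFDeriv,
    iteratedLineDerivOp_schwartzConv, schwartzConv_apply, ← integral_const_mul]
  congr 1
  ext x
  have h2 : BoundedForms.eval y m (φ x • weightedDeriv k l (schwartzTranslate η x)) =
      φ x * BoundedForms.eval y m (weightedDeriv k l (schwartzTranslate η x)) := rfl
  rw [h2, eval_weightedDeriv, iteratedFDeriv_translate,
    ← iteratedLineDerivOp_eq_iteratedFDeriv]
  ring

/-- The bound makes `f` vanish on the kernel of `T`, so it descends to a bounded functional on the
range of `T`, which Hahn–Banach extends. -/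
theorem LinearMap.exists_eq_clm_comp_of_norm_le {S E : Type*} [AddCommGroup S] [Module ℂ S]
    [NormedAddCommGroup E] [NormedSpace ℂ E] (f : S →ₗ[ℂ] ℂ) (T : S →ₗ[ℂ] E) {C : ℝ}
    (h : ∀ φ, ‖f φ‖ ≤ C * ‖T φ‖) : ∃ g : E →L[ℂ] ℂ, ∀ φ, f φ = g (T φ) := by
  have hker : f ∈ (LinearMap.ker T).dualAnnihilator := by
    rw [Submodule.mem_dualAnnihilator]
    intro φ hφ
    have := h φ
    rw [LinearMap.mem_ker.1 hφ, norm_zero, mul_zero] at this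
    exact norm_le_zero_iff.1 this
  rw [← LinearMap.range_dualMap_eq_dualAnnihilator_ker] at hker
  obtain ⟨g₀, hg₀⟩ := hker
  have hg : ∀ φ, g₀ (T φ) = f φ := fun φ => by rw [← hg₀]; rfl
  let g₁ : LinearMap.range T →L[ℂ] ℂ :=
    (g₀.comp (LinearMap.range T).subtype).mkContinuous C (by
      rintro ⟨_, φ, rfl⟩
      simpa [hg] using h φ)
  obtain ⟨g, hg', -⟩ := exists_extension_norm_eq (LinearMap.range T) g₁
  exact ⟨g, fun φ => by
    rw [hg' ⟨T φ, LinearMap.mem_range_self T φ⟩]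
    exact (hg φ).symm⟩

/-- The weighted derivatives with indices in `s`, as a map to a Banach space. -/
noncomputable def weightedDerivs {n : ℕ} (s : Finset (ℕ × ℕ)) :
    𝓢(Rn n, ℂ) →ₗ[ℂ] ((i : s) → BoundedForms n i.1.2) :=
  LinearMap.pi fun i => weightedDeriv i.1.1 i.1.2

/-- Continuity for the induced topology is a bound by finitely many Schwartz seminorms, each
dominated by the sup norm of a weighted derivative. -/
theorem SchwartzZeroDual.exists_eq_clm_comp_weightedDerivs {n : ℕ} (f : SchwartzZeroDual n) :
    ∃ (s : Finset (ℕ × ℕ)) (g : ((i : s) → BoundedForms n i.1.2) →L[ℂ] ℂ),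
      ∀ φ : schwartzZero n, f φ = g (weightedDerivs s φ.1) := by
  have hS := LinearMap.withSeminorms_induced (schwartz_withSeminorms ℂ (Rn n) ℂ)
    (schwartzZero n).subtype
  obtain ⟨s, C, -, hC⟩ := Seminorm.bound_of_continuous hS
    ((normSeminorm ℂ ℂ).comp f.toLinearMap) (by exact f.continuous.norm)
  refine ⟨s, LinearMap.exists_eq_clm_comp_of_norm_le f.toLinearMap
    ((weightedDerivs s).comp (schwartzZero n).subtype) (C := C) fun φ => ?_⟩
  refine (hC φ).trans ?_
  change (C : ℝ) * (s.sup ((schwartzSeminormFamily ℂ (Rn n) ℂ).comp (schwartzZero n).subtype)) φ ≤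
    C * ‖weightedDerivs s φ.1‖
  gcongr
  refine Seminorm.finset_sup_apply_le (norm_nonneg _) fun i hi => ?_
  exact (seminorm_le_norm_weightedDeriv i.1 i.2 φ.1).trans
    (norm_le_pi_norm (weightedDerivs s φ.1) ⟨i, hi⟩)

theorem SchwartzZeroDual.continuous_translate {n : ℕ} (f : SchwartzZeroDual n) (η : 𝓢(Rn n, ℂ))
    (hη : ∀ x, schwartzTranslate η x ∈ schwartzZero n) :
    Continuous fun x => f ⟨schwartzTranslate η x, hη x⟩ := by
  obtain ⟨s, g, hg⟩ := f.exists_eq_clm_comp_weightedDerivs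
  simp only [hg]
  exact g.continuous.comp (continuous_pi fun i => continuous_weightedDeriv_translate _ _ η)

/-- Once `f` is a bounded functional on a Banach space, it commutes with the Bochner integral that
expresses the convolution. -/
theorem SchwartzZeroDual.integral_mul_translate {n : ℕ} (f : SchwartzZeroDual n)
    (φ η : 𝓢(Rn n, ℂ)) (hη : ∀ x, schwartzTranslate η x ∈ schwartzZero n)
    (hc : schwartzConv φ η ∈ schwartzZero n) :
    ∫ x, φ x * f ⟨schwartzTranslate η x, hη x⟩ = f ⟨schwartzConv φ η, hc⟩ := by
  obtain ⟨s, g, hg⟩ := f.exists_eq_clm_comp_weightedDerivs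
  have hint : Integrable fun x => φ x • weightedDerivs s (schwartzTranslate η x) :=
    Integrable.of_eval fun i => integrable_smul_weightedDeriv_translate _ _ φ η
  have key : ∫ x, φ x • weightedDerivs s (schwartzTranslate η x) = weightedDerivs s (schwartzConv φ η) := by
    ext1 i
    have := (ContinuousLinearMap.proj (R := ℂ) (φ := fun i : s => BoundedForms n i.1.2)
      i).integral_comp_comm hint
    exact this.symm.trans <| integral_smul_weightedDeriv_translate _ _ φ η
  rw [hg, ← key, ← g.integral_comp_comm hint]
  simp only [hg, map_smul, smul_eq_mul]

/-! ### Littlewood–Paley pieces as functions -/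

theorem reflectTranslate_eq_schwartzTranslate {n : ℕ} (ψ : 𝓢(Rn n, ℂ)) (x : Rn n) :
    reflectTranslate ψ x = schwartzTranslate (reflectTranslate ψ 0) x := by
  ext y
  simp [reflectTranslate_apply]

/-- Exhibits the test functions as the translates of one fixed function, the form that
`continuous_translate` and `integral_mul_translate` need. -/
theorem lpPiece_eq {n : ℕ} (φ₀ : AnnulusBump n) (j : ℤ) (f : SchwartzZeroDual n) (x : Rn n) :
    lpPiece φ₀ j f x = f ⟨schwartzTranslate (reflectTranslate (φ₀.psi j) 0) x,
      reflectTranslate_eq_schwartzTranslate (φ₀.psi j) x ▸ reflectTranslate_psi_mem φ₀ j x⟩ := by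
  simp only [lpPiece, reflectTranslate_eq_schwartzTranslate (φ₀.psi j) x]

theorem continuous_lpPiece {n : ℕ} (φ₀ : AnnulusBump n) (j : ℤ) (f : SchwartzZeroDual n) :
    Continuous (lpPiece φ₀ j f) := by
  have := f.continuous_translate (reflectTranslate (φ₀.psi j) 0) fun x =>
    reflectTranslate_eq_schwartzTranslate (φ₀.psi j) x ▸ reflectTranslate_psi_mem φ₀ j x
  simpa only [← lpPiece_eq] using this

theorem fourier_reflect_psi {n : ℕ} (φ₀ : AnnulusBump n) (j : ℤ) (ξ : Rn n) :
    𝓕 (reflectTranslate (φ₀.psi j) 0) ξ = φ₀.symbol j (-ξ) := by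
  rw [fourier_reflectTranslate, AnnulusBump.psi, FourierTransform.fourier_fourierInv_eq]
  simp

/-- The convolution of `φ` with the reflection of `Ψ_j`. -/
noncomputable def lpTest {n : ℕ} (φ₀ : AnnulusBump n) (j : ℤ) (φ : 𝓢(Rn n, ℂ)) : 𝓢(Rn n, ℂ) :=
  schwartzConv φ (reflectTranslate (φ₀.psi j) 0)

theorem fourier_lpTest {n : ℕ} (φ₀ : AnnulusBump n) (j : ℤ) (φ : 𝓢(Rn n, ℂ)) (ξ : Rn n) :
    𝓕 (lpTest φ₀ j φ) ξ = 𝓕 φ ξ * φ₀.symbol j (-ξ) := by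
  rw [lpTest, fourier_schwartzConv_apply, fourier_reflect_psi]

/-- The symbol vanishes near the origin, so `φ` may be any Schwartz function. The reproducing
formula below uses this for a kernel that is not in `𝓢₀`. -/
theorem lpTest_mem {n : ℕ} (φ₀ : AnnulusBump n) (j : ℤ) (φ : 𝓢(Rn n, ℂ)) :
    lpTest φ₀ j φ ∈ schwartzZero n := by
  apply mem_schwartzZero_of_fourier_eventually_zero
  filter_upwards [Metric.ball_mem_nhds (0 : Rn n)
    (show (0 : ℝ) < (2 : ℝ) ^ (j - 1) by positivity)] with ξ hξ
  have : φ₀.symbol j (-ξ) = 0 :=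
    φ₀.symbolFun_zero_of_le (by rw [norm_neg]; exact (mem_ball_zero_iff.mp hξ).le)
  rw [fourier_lpTest, this, mul_zero]

theorem integral_mul_lpPiece {n : ℕ} (φ₀ : AnnulusBump n) (j : ℤ) (f : SchwartzZeroDual n)
    (φ : 𝓢(Rn n, ℂ)) :
    ∫ x, φ x * lpPiece φ₀ j f x = f ⟨lpTest φ₀ j φ, lpTest_mem φ₀ j φ⟩ := by
  simp only [lpPiece_eq]
  exact f.integral_mul_translate φ _ _ _

/-- The dilation `x ↦ 2^{jn} θ(2ʲ x)`. -/
noncomputable def schwartzDilate {n : ℕ} (j : ℤ) (θ : 𝓢(Rn n, ℂ)) : 𝓢(Rn n, ℂ) :=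
  (((2 : ℝ) ^ j) ^ n : ℝ) • compCLMOfContinuousLinearEquiv ℝ
    (LinearEquiv.smulOfNeZero ℝ (Rn n) ((2 : ℝ) ^ j) (by positivity)).toContinuousLinearEquiv θ

theorem schwartzDilate_apply {n : ℕ} (j : ℤ) (θ : 𝓢(Rn n, ℂ)) (x : Rn n) :
    schwartzDilate j θ x = (((2 : ℝ) ^ j) ^ n : ℝ) • θ ((2 : ℝ) ^ j • x) := rfl

theorem fourier_schwartzDilate {n : ℕ} (j : ℤ) (θ : 𝓢(Rn n, ℂ)) (ξ : Rn n) :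
    𝓕 (schwartzDilate j θ) ξ = 𝓕 θ ((2 : ℝ) ^ (-j) • ξ) := by
  rw [fourier_coe, fourier_coe, Real.fourier_eq, Real.fourier_eq]
  have h := Measure.integral_comp_smul (volume : Measure (Rn n))
    (fun y => Real.fourierChar (-inner ℝ y ((2 : ℝ) ^ (-j) • ξ)) • θ y) ((2 : ℝ) ^ j)
  have hj : (0 : ℝ) < (2 : ℝ) ^ j := by positivity
  rw [finrank_euclideanSpace_fin, abs_of_pos (by positivity), eq_inv_smul_iff₀ (by positivity),
    ← integral_smul] at h
  rw [← h]
  congr 1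
  ext x
  rw [schwartzDilate_apply, smul_comm]
  congr 3
  rw [inner_smul_left, inner_smul_right, zpow_neg]
  simp [hj.ne']

/-- A Schwartz function whose Fourier transform equals one on the ball of radius two. -/
theorem exists_schwartz_fourier_eq_one (n : ℕ) :
    ∃ θ : 𝓢(Rn n, ℂ), ∀ ξ : Rn n, ‖ξ‖ ≤ 2 → 𝓕 θ ξ = 1 := by
  let b : ContDiffBump (0 : Rn n) := ⟨2, 3, by norm_num, by norm_num⟩
  have h1 : ContDiff ℝ ∞ fun ξ => (b ξ : ℂ) := Complex.ofRealCLM.contDiff.comp b.contDiff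
  have h2 : HasCompactSupport fun ξ => (b ξ : ℂ) :=
    b.hasCompactSupport.comp_left (g := fun t : ℝ => (t : ℂ)) Complex.ofReal_zero
  refine ⟨𝓕⁻ (h2.toSchwartzMap h1), fun ξ hξ => ?_⟩
  rw [FourierTransform.fourier_fourierInv_eq]
  have : b ξ = 1 := b.one_of_mem_closedBall (by simpa [b] using hξ)
  change (b ξ : ℂ) = 1
  rw [this, Complex.ofReal_one]

/-- The symbol of `Δⱼ` vanishes for `‖ξ‖ ≥ 2^{j+1}`, and on the complement the Fourier transform of
the dilated kernel is one; hence the radius two in `hθ`. -/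
theorem integral_dilate_mul_lpPiece {n : ℕ} (φ₀ : AnnulusBump n) (j : ℤ) (f : SchwartzZeroDual n)
    {θ : 𝓢(Rn n, ℂ)} (hθ : ∀ ξ : Rn n, ‖ξ‖ ≤ 2 → 𝓕 θ ξ = 1) (x : Rn n) :
    ∫ z, schwartzDilate j θ (x - z) * lpPiece φ₀ j f z = lpPiece φ₀ j f x := by
  have key : lpTest φ₀ j (reflectTranslate (schwartzDilate j θ) x) =
      reflectTranslate (φ₀.psi j) x := by
    have h : 𝓕 (lpTest φ₀ j (reflectTranslate (schwartzDilate j θ) x)) =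
        𝓕 (reflectTranslate (φ₀.psi j) x) := by
      ext ξ
      rw [fourier_lpTest, fourier_reflectTranslate, fourier_reflectTranslate, AnnulusBump.psi,
        FourierTransform.fourier_fourierInv_eq, smul_mul_assoc, fourier_schwartzDilate]
      congr 1
      rcases le_or_gt ((2 : ℝ) ^ (j + 1)) ‖-ξ‖ with h | h
      · have : φ₀.symbol j (-ξ) = 0 := by
          change φ₀.symbolFun j (-ξ) = 0
          simp [AnnulusBump.symbolFun, φ₀.dil_zero_of_ge h]
        rw [this, mul_zero]
      · rw [hθ, one_mul]
        have hj : (0 : ℝ) < (2 : ℝ) ^ j := by positivity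
        rw [zpow_add_one₀ two_ne_zero] at h
        rw [AnnulusBump.norm_dil_arg, div_le_iff₀ hj]
        linarith
    have := congrArg (fun f => 𝓕⁻ f) h
    simpa using this
  have h := integral_mul_lpPiece φ₀ j f (reflectTranslate (schwartzDilate j θ) x)
  simp only [reflectTranslate_apply] at h
  rw [h, lpPiece]
  congr 1
  exact Subtype.ext key

/-! ### The Littlewood–Paley decomposition of `𝓢₀` -/

theorem hasTemperateGrowth_moment {n : ℕ} (γ : Fin n → ℕ) :
    (fun x : Rn n => ∏ i, (x i : ℂ) ^ γ i).HasTemperateGrowth := by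
  have h1 : ∀ i : Fin n, (fun x : Rn n => (x i : ℂ) ^ γ i).HasTemperateGrowth := fun i =>
    ((Complex.ofRealCLM ∘L (EuclideanSpace.proj i : Rn n →L[ℝ] ℝ)).hasTemperateGrowth).pow (γ i)
  classical
  have h2 : ∀ s : Finset (Fin n),
      (fun x : Rn n => ∏ i ∈ s, (x i : ℂ) ^ γ i).HasTemperateGrowth := by
    intro s
    induction s using Finset.induction_on with
    | empty => simp
    | insert a s ha ih => simp only [Finset.prod_insert ha]; exact (h1 a).mul ih
  exact h2 Finset.univ

theorem integrable_mul_moment {n : ℕ} (φ : 𝓢(Rn n, ℂ)) (γ : Fin n → ℕ) :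
    Integrable fun x : Rn n => φ x * ∏ i, (x i : ℂ) ^ γ i := by
  have := (smulLeftCLM ℂ (fun x : Rn n => ∏ i, (x i : ℂ) ^ γ i) φ).integrable
    (μ := (volume : Measure (Rn n)))
  rw [smulLeftCLM_apply (hasTemperateGrowth_moment γ)] at this
  simpa [mul_comm] using this

/-- Multiplying by a linear form turns each moment into a combination of moments with one index
raised by one. -/
theorem smulLeftCLM_inner_mem_schwartzZero {n : ℕ} {φ : 𝓢(Rn n, ℂ)} (hφ : φ ∈ schwartzZero n)
    (m : Rn n) : smulLeftCLM ℂ (fun y : Rn n => (inner ℝ y m : ℝ)) φ ∈ schwartzZero n := by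
  intro γ
  have hg : (fun y : Rn n => (inner ℝ y m : ℝ)).HasTemperateGrowth := by fun_prop
  have key : ∀ x : Rn n, (smulLeftCLM ℂ (fun y : Rn n => (inner ℝ y m : ℝ)) φ) x *
      ∏ i, (x i : ℂ) ^ γ i =
      ∑ l, (m l : ℂ) * (φ x * ∏ i, (x i : ℂ) ^ (γ + Pi.single l 1 : Fin n → ℕ) i) := by
    intro x
    have h1 : ∀ l, ∏ i, (x i : ℂ) ^ (γ + Pi.single l 1 : Fin n → ℕ) i = (∏ i, (x i : ℂ) ^ γ i) * x l := by
      intro l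
      simp only [Pi.add_apply, pow_add, Finset.prod_mul_distrib]
      congr 1
      rw [Finset.prod_eq_single l (fun i _ hi => by simp [hi]) (by simp)]
      simp
    rw [smulLeftCLM_apply_apply hg]
    simp only [h1, PiLp.inner_apply, RCLike.inner_apply, conj_trivial,
      Complex.real_smul, Complex.ofReal_sum, Complex.ofReal_mul, Finset.sum_mul]
    exact Finset.sum_congr rfl fun l _ => by ring
  simp only [key]
  rw [integral_finsetSum _ fun l _ => (integrable_mul_moment φ _).const_mul _]
  refine Finset.sum_eq_zero fun l _ => ?_
  rw [integral_const_mul, hφ, mul_zero]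

theorem fourier_zero_of_mem_schwartzZero {n : ℕ} {φ : 𝓢(Rn n, ℂ)} (hφ : φ ∈ schwartzZero n) :
    𝓕 φ 0 = 0 := by
  have := hφ 0
  rw [fourier_coe, Real.fourier_eq]
  simpa using this

/-- A derivative of `𝓕 φ` is, up to a constant, the Fourier transform of `φ` times a linear form,
again in `𝓢₀`. Induction reduces everything to the vanishing of the integral. -/
theorem iteratedLineDerivOp_fourier_zero {n l : ℕ} (m : Fin l → Rn n) {φ : 𝓢(Rn n, ℂ)}
    (hφ : φ ∈ schwartzZero n) : (∂^{m} (𝓕 φ)) 0 = 0 := by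
  induction l generalizing φ with
  | zero => simpa using fourier_zero_of_mem_schwartzZero hφ
  | succ l ih =>
    rw [LineDeriv.iteratedLineDerivOp_succ_right, lineDerivOp_fourier_eq]
    exact ih _ ((schwartzZero n).smul_mem _ (smulLeftCLM_inner_mem_schwartzZero hφ _))

theorem iteratedFDeriv_fourier_zero {n : ℕ} (l : ℕ) {φ : 𝓢(Rn n, ℂ)} (hφ : φ ∈ schwartzZero n) :
    iteratedFDeriv ℝ l (𝓕 φ : 𝓢(Rn n, ℂ)) 0 = 0 := by
  ext m
  rw [← iteratedLineDerivOp_eq_iteratedFDeriv, iteratedLineDerivOp_fourier_zero m hφ]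
  simp

/-- A Schwartz function that vanishes to infinite order at the origin is `O(‖ξ‖ᵇ)` there, with all
its derivatives. -/
theorem SchwartzMap.norm_iteratedFDeriv_le_pow {n : ℕ} {g : 𝓢(Rn n, ℂ)}
    (hg : ∀ l, iteratedFDeriv ℝ l g 0 = 0) (b l : ℕ) :
    ∃ C : ℝ, 0 ≤ C ∧ ∀ ξ, ‖iteratedFDeriv ℝ l g ξ‖ ≤ C * ‖ξ‖ ^ b := by
  induction b generalizing l with
  | zero =>
    refine ⟨SchwartzMap.seminorm ℂ 0 l g, apply_nonneg _ _, fun ξ => ?_⟩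
    simpa using SchwartzMap.norm_iteratedFDeriv_le_seminorm ℂ g l ξ
  | succ b ih =>
    -- The mean value inequality on the ball of radius `‖ξ‖` spends one derivative to gain one power
    -- of `‖ξ‖`, since the value at the origin is zero.
    obtain ⟨C, hC, h⟩ := ih (l + 1)
    refine ⟨C, hC, fun ξ => ?_⟩
    have hd : Differentiable ℝ (iteratedFDeriv ℝ l g) :=
      (g.smooth ⊤).differentiable_iteratedFDeriv (mod_cast ENat.natCast_lt_top l)
    have := (convex_closedBall (0 : Rn n) ‖ξ‖).norm_image_sub_le_of_norm_fderiv_le (𝕜 := ℝ)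
      (f := iteratedFDeriv ℝ l g) (C := C * ‖ξ‖ ^ b) (fun x _ => hd x) (fun x hx => by
        rw [norm_fderiv_iteratedFDeriv]
        refine (h x).trans ?_
        have := mem_closedBall_zero_iff.1 hx
        gcongr) (Metric.mem_closedBall_self (norm_nonneg _))
      (mem_closedBall_zero_iff.2 le_rfl : ξ ∈ Metric.closedBall (0 : Rn n) ‖ξ‖)
    rw [hg l, sub_zero, sub_zero] at this
    rw [pow_succ, ← mul_assoc]
    exact this

/-! ### Scaling of the dyadic symbols and the partition of unity -/

namespace AnnulusBump

variable {n : ℕ}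

theorem dil_two_zpow_smul (φ₀ : AnnulusBump n) (j k : ℤ) (ξ : Rn n) :
    φ₀.dil k ((2 : ℝ) ^ (-j) • ξ) = φ₀.dil (k + j) ξ := by
  rw [dil, dil, smul_smul, ← zpow_add₀ two_ne_zero, neg_add]

theorem symbolFun_eq (φ₀ : AnnulusBump n) (j : ℤ) (ξ : Rn n) :
    φ₀.symbolFun j ξ = φ₀.symbolFun 0 ((2 : ℝ) ^ (-j) • ξ) := by
  rw [symbolFun, symbolFun]
  simp only [dil_two_zpow_smul, zero_add]
  rw [← (Equiv.addRight j).tsum_eq (fun k => φ₀.dil k ξ)]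
  rfl

/-- All symbols are dilates of the one with index zero, so each derivative costs a factor `2^{-j}`.
-/
theorem norm_iteratedFDeriv_symbol_le (φ₀ : AnnulusBump n) (i : ℕ) (j : ℤ) (ξ : Rn n) :
    ‖iteratedFDeriv ℝ i (fun ξ => φ₀.symbolFun j (-ξ)) ξ‖ ≤
      SchwartzMap.seminorm ℂ 0 i (φ₀.symbol 0) * ((2 : ℝ) ^ (-j)) ^ i := by
  let L : Rn n →L[ℝ] Rn n := (-(2 : ℝ) ^ (-j)) • ContinuousLinearMap.id ℝ (Rn n)
  have h1 : (fun ξ => φ₀.symbolFun j (-ξ)) = φ₀.symbol 0 ∘ L := by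
    ext ξ
    rw [symbolFun_eq]
    change _ = φ₀.symbolFun 0 (L ξ)
    simp [L]
  have hL : ‖L‖ ≤ (2 : ℝ) ^ (-j) := by
    refine ContinuousLinearMap.opNorm_le_bound _ (by positivity) fun x => ?_
    simp only [L, smul_apply, ContinuousLinearMap.id_apply, norm_smul, norm_neg]
    rw [Real.norm_of_nonneg (by positivity)]
  rw [h1, L.iteratedFDeriv_comp_right ((φ₀.symbol 0).smooth ⊤) ξ (i := i) (mod_cast le_top)]
  refine (ContinuousMultilinearMap.norm_compContinuousLinearMap_le _ _).trans ?_
  rw [Finset.prod_const, Finset.card_univ, Fintype.card_fin]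
  gcongr
  exact SchwartzMap.norm_iteratedFDeriv_le_seminorm ℂ (φ₀.symbol 0) i (L ξ)

theorem symbolFun_eventually_zero (φ₀ : AnnulusBump n) {j : ℤ} {ξ : Rn n}
    (h : ‖ξ‖ < (2 : ℝ) ^ (j - 1) ∨ (2 : ℝ) ^ (j + 1) < ‖ξ‖) :
    (fun ξ => φ₀.symbolFun j (-ξ)) =ᶠ[𝓝 ξ] 0 := by
  rcases h with h | h
  · filter_upwards [continuous_norm.continuousAt.eventually (eventually_lt_nhds h)] with η hη
    simpa using φ₀.symbolFun_zero_of_le (by rw [norm_neg]; exact hη.le)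
  · filter_upwards [continuous_norm.continuousAt.eventually (eventually_gt_nhds h)] with η hη
    have : φ₀.dil j (-η) = 0 := φ₀.dil_zero_of_ge (by rw [norm_neg]; exact hη.le)
    simp [symbolFun, this]

/-- Only annuli with index near `m` meet this one; the window of five indices is generous. -/
theorem sum_symbolFun (φ₀ : AnnulusBump n) {m : ℤ} {ξ : Rn n} (h1 : (2 : ℝ) ^ (m - 1) < ‖ξ‖)
    (h2 : ‖ξ‖ < (2 : ℝ) ^ (m + 1)) :
    ∑ j ∈ Finset.Icc (m - 2) (m + 2), φ₀.symbolFun j ξ = 1 := by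
  have h : ∑' k : ℤ, φ₀.dil k ξ = ∑ k ∈ Finset.Icc (m - 2) (m + 2), φ₀.dil k ξ := by
    apply tsum_eq_sum
    intro k hk
    rw [Finset.mem_Icc, not_and_or, not_le, not_le] at hk
    rcases hk with hk | hk
    · exact φ₀.dil_zero_of_ge
        ((zpow_le_zpow_right₀ one_le_two (by omega : k + 1 ≤ m - 1)).trans h1.le)
    · exact φ₀.dil_zero_of_le
        (h2.le.trans (zpow_le_zpow_right₀ one_le_two (by omega : m + 1 ≤ k - 1)))
  have hpos : 0 < ∑ k ∈ Finset.Icc (m - 2) (m + 2), φ₀.dil k ξ :=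
    Finset.sum_pos' (fun k _ => φ₀.dil_nonneg k ξ) ⟨m, by simp, φ₀.dil_pos h1 h2⟩
  simp only [symbolFun, h]
  rw [← Complex.ofReal_sum, ← Finset.sum_div, div_self hpos.ne', Complex.ofReal_one]

end AnnulusBump

/-- For `j ≥ 0` one extra power of `‖ξ‖` in the Schwartz seminorm gives the decay. For `j < 0`
vanishing at the origin to order `i + 1` pays for the factor `2^{-ji}` and leaves one power of `2ʲ`.
-/
theorem norm_iteratedFDeriv_le_dyadic {n : ℕ} {g : 𝓢(Rn n, ℂ)}
    (hg : ∀ l, iteratedFDeriv ℝ l g 0 = 0) (k i m : ℕ) :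
    ∃ C : ℝ, 0 ≤ C ∧ ∀ (j : ℤ) (ξ : Rn n), (2 : ℝ) ^ (j - 1) ≤ ‖ξ‖ → ‖ξ‖ ≤ (2 : ℝ) ^ (j + 1) →
      ((2 : ℝ) ^ (-j)) ^ i * (‖ξ‖ ^ k * ‖iteratedFDeriv ℝ m g ξ‖) ≤ C * (1 / 2) ^ j.natAbs := by
  obtain ⟨C, hC, h⟩ := SchwartzMap.norm_iteratedFDeriv_le_pow hg (i + 1) m
  refine ⟨2 * SchwartzMap.seminorm ℂ (k + 1) m g + 2 ^ k * 2 ^ (i + 1) * C, by positivity,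
    fun j ξ h1 h2 => ?_⟩
  have hj : (0 : ℝ) < (2 : ℝ) ^ j := by positivity
  rw [zpow_sub_one₀ two_ne_zero] at h1
  rw [zpow_add_one₀ two_ne_zero] at h2
  rw [zpow_neg]
  set t : ℝ := (2 : ℝ) ^ j with ht
  rcases le_or_gt 0 j with hj0 | hj0
  · have ht1 : 1 ≤ t := one_le_zpow₀ one_le_two hj0
    have e : ((1 : ℝ) / 2) ^ j.natAbs = t⁻¹ := by
      rw [one_div, inv_pow, ← zpow_natCast, Int.natCast_natAbs, abs_of_nonneg hj0]
    rw [e, ← div_eq_mul_inv, le_div_iff₀ hj]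
    have h3 := SchwartzMap.le_seminorm ℂ (k + 1) m g ξ
    calc t⁻¹ ^ i * (‖ξ‖ ^ k * ‖iteratedFDeriv ℝ m g ξ‖) * t
        ≤ 1 * (‖ξ‖ ^ k * ‖iteratedFDeriv ℝ m g ξ‖) * (2 * ‖ξ‖) := by
          gcongr
          · exact pow_le_one₀ (by positivity) (inv_le_one_of_one_le₀ ht1)
          · linarith
      _ = 2 * (‖ξ‖ ^ (k + 1) * ‖iteratedFDeriv ℝ m g ξ‖) := by ring
      _ ≤ 2 * SchwartzMap.seminorm ℂ (k + 1) m g := by gcongr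
      _ ≤ _ := by simp only [le_add_iff_nonneg_right]; positivity
  · have ht1 : t ≤ 1 := zpow_le_one_of_nonpos₀ one_le_two hj0.le
    have e : ((1 : ℝ) / 2) ^ j.natAbs = t := by
      rw [one_div, inv_pow, ← zpow_natCast, Int.natCast_natAbs, abs_of_neg hj0, zpow_neg, inv_inv]
    rw [e]
    calc t⁻¹ ^ i * (‖ξ‖ ^ k * ‖iteratedFDeriv ℝ m g ξ‖)
        ≤ t⁻¹ ^ i * ((t * 2) ^ k * (C * (t * 2) ^ (i + 1))) := by
          gcongr
          exact (h ξ).trans (by gcongr)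
      _ = t ^ k * (2 ^ k * 2 ^ (i + 1) * C * t) := by
          have : t⁻¹ ^ i * t ^ i = 1 := by rw [← mul_pow, inv_mul_cancel₀ hj.ne', one_pow]
          rw [mul_pow, mul_pow t 2 (i + 1), pow_succ t i]
          linear_combination t ^ k * (2 ^ k * 2 ^ (i + 1) * C * t) * this
      _ ≤ 1 * (2 ^ k * 2 ^ (i + 1) * C * t) := by
          gcongr
          exact pow_le_one₀ hj.le ht1
      _ ≤ _ := by
          rw [one_mul]
          gcongr
          simp only [le_add_iff_nonneg_left]
          positivity

/-- Leibniz's rule: derivatives falling on the symbol cost powers of `2^{-j}`, which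
`norm_iteratedFDeriv_le_dyadic` compensates on the annulus. Off the closed annulus the product
vanishes near `ξ`. -/
theorem seminorm_fourier_lpTest_le {n : ℕ} (φ₀ : AnnulusBump n) {φ : 𝓢(Rn n, ℂ)}
    (hφ : φ ∈ schwartzZero n) (k l : ℕ) :
    ∃ C : ℝ, 0 ≤ C ∧ ∀ j : ℤ,
      SchwartzMap.seminorm ℂ k l (𝓕 (lpTest φ₀ j φ)) ≤ C * (1 / 2) ^ j.natAbs := by
  choose A hA h using fun i m => norm_iteratedFDeriv_le_dyadic
    (g := 𝓕 φ) (fun l => iteratedFDeriv_fourier_zero l hφ) k i m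
  refine ⟨∑ i ∈ Finset.range (l + 1),
    (l.choose i : ℝ) * SchwartzMap.seminorm ℂ 0 i (φ₀.symbol 0) * A i (l - i),
    Finset.sum_nonneg fun i _ => mul_nonneg (by positivity) (hA _ _), fun j => ?_⟩
  have hnn : 0 ≤ (∑ i ∈ Finset.range (l + 1),
    (l.choose i : ℝ) * SchwartzMap.seminorm ℂ 0 i (φ₀.symbol 0) * A i (l - i)) * (1 / 2) ^ j.natAbs :=
    mul_nonneg (Finset.sum_nonneg fun i _ => mul_nonneg (by positivity) (hA _ _)) (by positivity)
  refine SchwartzMap.seminorm_le_bound ℂ k l _ hnn fun ξ => ?_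
  have hfun : (⇑(𝓕 (lpTest φ₀ j φ) : 𝓢(Rn n, ℂ)) : Rn n → ℂ) = fun ξ => φ₀.symbolFun j (-ξ) * 𝓕 φ ξ := by
    ext ξ
    rw [fourier_lpTest, mul_comm]
    rfl
  rw [hfun]
  by_cases hξ : ‖ξ‖ < (2 : ℝ) ^ (j - 1) ∨ (2 : ℝ) ^ (j + 1) < ‖ξ‖
  · have h0 : (fun ξ => φ₀.symbolFun j (-ξ) * 𝓕 φ ξ) =ᶠ[𝓝 ξ] 0 := by
      filter_upwards [φ₀.symbolFun_eventually_zero hξ] with η hη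
      simp only [Pi.zero_apply] at hη ⊢
      rw [hη, zero_mul]
    rw [(h0.iteratedFDeriv ℝ l).self_of_nhds]
    simpa using hnn
  · rw [not_or, not_lt, not_lt] at hξ
    have hs : ContDiff ℝ ∞ fun ξ => φ₀.symbolFun j (-ξ) :=
      (φ₀.contDiff_symbolFun j).comp contDiff_neg
    have hm := norm_iteratedFDeriv_mul_le hs ((𝓕 φ).smooth ⊤) ξ (n := l) (mod_cast le_top)
    calc _ ≤ ‖ξ‖ ^ k * ∑ i ∈ Finset.range (l + 1), (l.choose i : ℝ) *
            ‖iteratedFDeriv ℝ i (fun ξ => φ₀.symbolFun j (-ξ)) ξ‖ *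
            ‖iteratedFDeriv ℝ (l - i) (𝓕 φ : 𝓢(Rn n, ℂ)) ξ‖ := by gcongr
      _ ≤ ‖ξ‖ ^ k * ∑ i ∈ Finset.range (l + 1), (l.choose i : ℝ) *
            (SchwartzMap.seminorm ℂ 0 i (φ₀.symbol 0) * ((2 : ℝ) ^ (-j)) ^ i) *
            ‖iteratedFDeriv ℝ (l - i) (𝓕 φ : 𝓢(Rn n, ℂ)) ξ‖ := by
          gcongr with i hi
          exact φ₀.norm_iteratedFDeriv_symbol_le i j ξ
      _ = ∑ i ∈ Finset.range (l + 1), (l.choose i : ℝ) *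
            SchwartzMap.seminorm ℂ 0 i (φ₀.symbol 0) * (((2 : ℝ) ^ (-j)) ^ i *
            (‖ξ‖ ^ k * ‖iteratedFDeriv ℝ (l - i) (𝓕 φ : 𝓢(Rn n, ℂ)) ξ‖)) := by
          rw [Finset.mul_sum]
          exact Finset.sum_congr rfl fun i _ => by ring
      _ ≤ ∑ i ∈ Finset.range (l + 1), (l.choose i : ℝ) *
            SchwartzMap.seminorm ℂ 0 i (φ₀.symbol 0) * (A i (l - i) * (1 / 2) ^ j.natAbs) := by
          refine Finset.sum_le_sum fun i _ => ?_
          exact mul_le_mul_of_nonneg_left (h i (l - i) j ξ hξ.1 hξ.2) (by positivity)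
      _ = _ := by
          rw [Finset.sum_mul]
          exact Finset.sum_congr rfl fun i _ => by ring

theorem summable_pow_natAbs {r : ℝ} (h0 : 0 ≤ r) (h1 : r < 1) :
    Summable fun j : ℤ => r ^ j.natAbs := by
  refine Summable.of_nat_of_neg ?_ ?_ <;> simpa using summable_geometric_of_lt_one h0 h1

theorem seminorm_sub_sum_fourier_lpTest_le {n : ℕ} (φ₀ : AnnulusBump n) {φ : 𝓢(Rn n, ℂ)}
    (hφ : φ ∈ schwartzZero n) (k l : ℕ) (s : Finset ℤ) :
    SchwartzMap.seminorm ℂ k l (∑ j ∈ s, 𝓕 (lpTest φ₀ j φ) - 𝓕 φ) ≤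
      ∑' j : {j // j ∉ s}, SchwartzMap.seminorm ℂ k l (𝓕 (lpTest φ₀ j φ)) := by
  obtain ⟨C, hC, hb⟩ := seminorm_fourier_lpTest_le φ₀ hφ k l
  have hsum : Summable fun j : ℤ => SchwartzMap.seminorm ℂ k l (𝓕 (lpTest φ₀ j φ)) :=
    Summable.of_nonneg_of_le (fun _ => apply_nonneg _ _) hb
      ((summable_pow_natAbs (by norm_num) (by norm_num)).mul_left C)
  refine SchwartzMap.seminorm_le_bound ℂ k l _ (tsum_nonneg fun _ => apply_nonneg _ _) fun ξ => ?_
  by_cases h0 : ξ = 0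
  -- No annulus reaches the origin, but there every derivative is zero because all the functions
  -- come from `𝓢₀`.
  · subst h0
    have hmem : ∑ j ∈ s, lpTest φ₀ j φ - φ ∈ schwartzZero n :=
      (schwartzZero n).sub_mem ((schwartzZero n).sum_mem fun j _ => lpTest_mem φ₀ j φ) hφ
    have e : ∑ j ∈ s, 𝓕 (lpTest φ₀ j φ) - 𝓕 φ = 𝓕 (∑ j ∈ s, lpTest φ₀ j φ - φ) := by
      change ∑ j ∈ s, fourierTransformCLM ℂ (lpTest φ₀ j φ) - fourierTransformCLM ℂ φ =
        fourierTransformCLM ℂ (∑ j ∈ s, lpTest φ₀ j φ - φ)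
      rw [map_sub, map_sum]
    have h1 : ‖(0 : Rn n)‖ ^ k * ‖iteratedFDeriv ℝ l
        (𝓕 (∑ j ∈ s, lpTest φ₀ j φ - φ) : 𝓢(Rn n, ℂ)) 0‖ = 0 := by
      rw [iteratedFDeriv_fourier_zero l hmem]
      exact mul_eq_zero_of_right _ norm_zero
    rw [e, h1]
    exact tsum_nonneg fun _ => apply_nonneg _ _
  · obtain ⟨m, hm1, hm2⟩ := exists_mem_Ico_zpow (norm_pos_iff.mpr h0) (one_lt_two : (1 : ℝ) < 2)
    have hlt : (2 : ℝ) ^ (m - 1) < ‖ξ‖ :=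
      lt_of_lt_of_le (zpow_lt_zpow_right₀ one_lt_two (by omega)) hm1
    set t : Finset ℤ := Finset.Icc (m - 2) (m + 2)
    -- Near `ξ` the symbols with index in `t` add up to one and those in `s \ t` vanish, so the
    -- error is exactly the contribution of the indices of `t` missing from `s`.
    have hev : (⇑(∑ j ∈ s, 𝓕 (lpTest φ₀ j φ) - 𝓕 φ) : Rn n → ℂ) =ᶠ[𝓝 ξ]
        ⇑(-∑ j ∈ t \ s, 𝓕 (lpTest φ₀ j φ)) := by
      have hvan : ∀ᶠ η in 𝓝 ξ, ∀ j ∈ s \ t, φ₀.symbolFun j (-η) = 0 := by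
        rw [Filter.eventually_all_finset]
        intro j hj
        refine φ₀.symbolFun_eventually_zero ?_
        rw [Finset.mem_sdiff, Finset.mem_Icc, not_and_or, not_le, not_le] at hj
        rcases hj.2 with hj | hj
        · exact Or.inr ((zpow_le_zpow_right₀ one_le_two (by omega : j + 1 ≤ m - 1)).trans_lt hlt)
        · exact Or.inl (hm2.trans_le
            (zpow_le_zpow_right₀ one_le_two (by omega : m + 1 ≤ j - 1)))
      filter_upwards [continuous_norm.continuousAt.eventually (eventually_gt_nhds hlt),
        continuous_norm.continuousAt.eventually (eventually_lt_nhds hm2), hvan] with η h1 h2 h3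
      have h4 := φ₀.sum_symbolFun (m := m) (ξ := -η) (by rwa [norm_neg]) (by rwa [norm_neg])
      have h5 : ∀ u : Finset ℤ, (∑ j ∈ u, 𝓕 (lpTest φ₀ j φ)) η =
          𝓕 φ η * ∑ j ∈ u, φ₀.symbolFun j (-η) := by
        intro u
        rw [_root_.sum_apply, Finset.mul_sum]
        exact Finset.sum_congr rfl fun j _ => fourier_lpTest φ₀ j φ η
      rw [_root_.sub_apply, _root_.neg_apply, h5, h5]
      have h6 := (Finset.sum_inter_add_sum_sdiff s t fun j => φ₀.symbolFun j (-η))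
      have h7 := (Finset.sum_inter_add_sum_sdiff t s fun j => φ₀.symbolFun j (-η))
      rw [Finset.sum_eq_zero h3, add_zero] at h6
      rw [Finset.inter_comm, h6] at h7
      rw [h4] at h7
      linear_combination (𝓕 φ : 𝓢(Rn n, ℂ)) η * h7
    rw [(hev.iteratedFDeriv ℝ l).self_of_nhds]
    refine (SchwartzMap.le_seminorm ℂ k l _ ξ).trans ?_
    rw [map_neg_eq_map]
    calc _ ≤ ∑ j ∈ t \ s, SchwartzMap.seminorm ℂ k l (𝓕 (lpTest φ₀ j φ)) :=
          Finset.le_sum_of_subadditive _ (map_zero _).le (fun _ _ => map_add_le_add _ _ _) _ _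
      _ = ∑ j ∈ (t \ s).subtype (· ∉ s), SchwartzMap.seminorm ℂ k l (𝓕 (lpTest φ₀ j φ)) := by
          rw [Finset.sum_subtype_of_mem (fun j => SchwartzMap.seminorm ℂ k l (𝓕 (lpTest φ₀ j φ)))]
          intro j hj
          exact (Finset.mem_sdiff.1 hj).2
      _ ≤ _ := (hsum.subtype _).sum_le_tsum _ fun _ _ => apply_nonneg _ _

theorem hasSum_lpTest {n : ℕ} (φ₀ : AnnulusBump n) {φ : 𝓢(Rn n, ℂ)} (hφ : φ ∈ schwartzZero n) :
    HasSum (fun j => lpTest φ₀ j φ) φ := by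
  have h : HasSum (fun j => 𝓕 (lpTest φ₀ j φ)) (𝓕 φ) := by
    rw [HasSum, (schwartz_withSeminorms ℂ (Rn n) ℂ).tendsto_nhds]
    rintro ⟨k, l⟩ ε hε
    have ht := tendsto_tsum_compl_atTop_zero
      fun j : ℤ => SchwartzMap.seminorm ℂ k l (𝓕 (lpTest φ₀ j φ))
    filter_upwards [ht.eventually (eventually_lt_nhds hε)] with s hs
    exact (seminorm_sub_sum_fourier_lpTest_le φ₀ hφ k l s).trans_lt hs
  have := h.mapL (fourierInvCLM ℂ 𝓢(Rn n, ℂ))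
  simpa using this

theorem SchwartzZeroDual.hasSum_integral_lpPiece {n : ℕ} (φ₀ : AnnulusBump n)
    (f : SchwartzZeroDual n) (φ : schwartzZero n) :
    HasSum (fun j => ∫ x, φ.1 x * lpPiece φ₀ j f x) (f φ) := by
  simp only [integral_mul_lpPiece]
  refine HasSum.mapL (f := fun j => (⟨lpTest φ₀ j φ.1, lpTest_mem φ₀ j φ.1⟩ : schwartzZero n)) f ?_
  -- The topology of `𝓢₀` is induced, so convergence is tested in the Schwartz space.
  rw [HasSum, tendsto_subtype_rng]
  simpa [HasSum] using hasSum_lpTest φ₀ φ.2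

/-! ### Bernstein type estimates -/

/-- Jensen's inequality for a weight of finite mass. -/
theorem ENNReal.lintegral_mul_rpow_le {X : Type*} [MeasurableSpace X] {μ : Measure X}
    {k v : X → ℝ≥0∞} (hk : AEMeasurable k μ) (hv : AEMeasurable v μ) {p : ℝ} (hp : 1 ≤ p) :
    (∫⁻ x, k x * v x ∂μ) ^ p ≤ (∫⁻ x, k x ∂μ) ^ (p - 1) * ∫⁻ x, k x * v x ^ p ∂μ := by
  rcases hp.eq_or_lt with rfl | hp
  · simp
  have hpq := Real.HolderConjugate.conjExponent hp
  set q := p.conjExponent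
  have h0 : 0 < p := hpq.pos
  have h0' : 0 < q := hpq.symm.pos
  -- Hölder's inequality after splitting the weight as `k = k^{1/p} k^{1/q}`.
  have h := ENNReal.lintegral_mul_le_Lp_mul_Lq μ hpq
    (f := fun x => k x ^ (1 / p) * v x) (g := fun x => k x ^ (1 / q))
    ((hk.pow_const _).mul hv) (hk.pow_const _)
  have e1 : ∀ x, ((fun x => k x ^ (1 / p) * v x) * fun x => k x ^ (1 / q)) x = k x * v x := by
    intro x
    simp only [Pi.mul_apply]
    rw [mul_right_comm, ← ENNReal.rpow_add_of_nonneg _ _ (by positivity) (by positivity)]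
    have : 1 / p + 1 / q = 1 := by simpa using hpq.inv_add_inv_eq_one
    rw [this, ENNReal.rpow_one]
  have e2 : ∀ x, (k x ^ (1 / p) * v x) ^ p = k x * v x ^ p := by
    intro x
    rw [ENNReal.mul_rpow_of_nonneg _ _ h0.le, ← ENNReal.rpow_mul, one_div_mul_cancel h0.ne',
      ENNReal.rpow_one]
  have e3 : ∀ x, (k x ^ (1 / q)) ^ q = k x := by
    intro x
    rw [← ENNReal.rpow_mul, one_div_mul_cancel h0'.ne', ENNReal.rpow_one]
  simp only [e1, e2, e3] at h
  calc _ ≤ ((∫⁻ x, k x * v x ^ p ∂μ) ^ (1 / p) * (∫⁻ x, k x ∂μ) ^ (1 / q)) ^ p := by gcongr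
    _ = _ := by
      rw [ENNReal.mul_rpow_of_nonneg _ _ h0.le, ← ENNReal.rpow_mul, ← ENNReal.rpow_mul,
        one_div_mul_cancel h0.ne', ENNReal.rpow_one, mul_comm]
      congr 2
      have : 1 / q = 1 - 1 / p := by
        have := hpq.inv_add_inv_eq_one
        rw [one_div, one_div]; linarith
      rw [this]
      field_simp

/-- For `‖h‖ ≤ 1` the mean value inequality gives a factor `‖h‖` against an integrable weight; for
larger `h` twice the `L¹` norm suffices. The weights `0` and `n + 1` in `M` together control `(1 +
‖y‖)^{n+1}`. -/
theorem SchwartzMap.exists_integral_norm_translate_sub_le {n : ℕ} (θ : 𝓢(Rn n, ℂ)) :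
    ∃ C : ℝ, 0 ≤ C ∧ ∀ h : Rn n, ∫ y, ‖θ (y + h) - θ y‖ ≤ C * min 1 ‖h‖ := by
  set M : ℝ := ∑ k ∈ ({0, n + 1} : Finset ℕ), 2 ^ k * (SchwartzMap.seminorm ℂ k 1 θ +
    SchwartzMap.seminorm ℂ 0 1 θ) with hM
  set W : ℝ := ∫ y : Rn n, (1 + ‖y‖) ^ (-((n : ℝ) + 1)) with hW
  have hWi : Integrable fun y : Rn n => (1 + ‖y‖) ^ (-((n : ℝ) + 1)) :=
    integrable_one_add_norm (by simp)
  have hW0 : 0 ≤ W := integral_nonneg fun y => by positivity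
  have hM0 : 0 ≤ M := Finset.sum_nonneg fun k _ => by positivity
  have hk : ∀ k (h y : Rn n), ‖h‖ ≤ 1 → ‖y‖ ^ k * ‖θ (y + h) - θ y‖ ≤
      2 ^ k * (SchwartzMap.seminorm ℂ k 1 θ + SchwartzMap.seminorm ℂ 0 1 θ) * ‖h‖ := by
    intro k h y hh
    have := mul_norm_sub_comp_sub_le θ.differentiable (c := ‖y‖ ^ k) (by positivity) (a := 0)
      (b := -h) y (by simpa using hh) (M := 2 ^ k * (SchwartzMap.seminorm ℂ k 1 θ +
        SchwartzMap.seminorm ℂ 0 1 θ)) (fun x hx => by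
        rw [← norm_iteratedFDeriv_one]
        refine (weighted_iteratedFDeriv_sub_le k 1 θ x y).trans ?_
        have h1 : ‖x‖ ^ k ≤ 1 := pow_le_one₀ (norm_nonneg _) (mem_closedBall_zero_iff.1 hx)
        gcongr
        exact mul_le_of_le_one_left (apply_nonneg _ _) h1)
    simpa using this
  have hpt : ∀ h y : Rn n, ‖h‖ ≤ 1 → ‖θ (y + h) - θ y‖ ≤
      2 ^ n * M * ‖h‖ * (1 + ‖y‖) ^ (-((n : ℝ) + 1)) := by
    intro h y hh
    have h1 := hk 0 h y hh
    have h2 := hk (n + 1) h y hh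
    have h3 : (1 + ‖y‖) ^ (n + 1) ≤ 2 ^ n * (1 + ‖y‖ ^ (n + 1)) := by
      simpa using add_pow_le zero_le_one (norm_nonneg y) (n + 1)
    have h4 : (1 + ‖y‖ ^ (n + 1)) * ‖θ (y + h) - θ y‖ ≤ M * ‖h‖ := by
      rw [hM, Finset.sum_pair (by omega)]
      rw [pow_zero, one_mul] at h1
      linarith
    rw [Real.rpow_neg (by positivity), ← div_eq_mul_inv, le_div_iff₀ (by positivity)]
    have h5 : (1 + ‖y‖) ^ ((n : ℝ) + 1) = (1 + ‖y‖) ^ (n + 1) := by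
      rw [← Real.rpow_natCast]; push_cast; rfl
    rw [h5]
    calc _ ≤ ‖θ (y + h) - θ y‖ * (2 ^ n * (1 + ‖y‖ ^ (n + 1))) := by gcongr
      _ = 2 ^ n * ((1 + ‖y‖ ^ (n + 1)) * ‖θ (y + h) - θ y‖) := by ring
      _ ≤ 2 ^ n * (M * ‖h‖) := by gcongr
      _ = _ := by ring
  refine ⟨2 * (∫ y, ‖θ y‖) + 2 ^ n * M * W, by positivity, fun h => ?_⟩
  have hI : 0 ≤ ∫ y, ‖θ y‖ := integral_nonneg fun _ => norm_nonneg _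
  rcases le_or_gt ‖h‖ 1 with hh | hh
  · rw [min_eq_right hh]
    calc _ ≤ ∫ y : Rn n, 2 ^ n * M * ‖h‖ * (1 + ‖y‖) ^ (-((n : ℝ) + 1)) :=
          integral_mono_of_nonneg (Eventually.of_forall fun _ => norm_nonneg _)
            (hWi.const_mul _) (Eventually.of_forall fun y => hpt h y hh)
      _ = 2 ^ n * M * W * ‖h‖ := by rw [integral_const_mul]; ring
      _ ≤ _ := by gcongr; linarith
  · rw [min_eq_left hh.le, mul_one]
    calc _ ≤ ∫ y : Rn n, (‖θ (y + h)‖ + ‖θ y‖) :=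
          integral_mono_of_nonneg (Eventually.of_forall fun _ => norm_nonneg _)
            ((θ.integrable.comp_add_right h).norm.add θ.integrable.norm)
            (Eventually.of_forall fun y => norm_sub_le _ _)
      _ = 2 * ∫ y, ‖θ y‖ := by
          rw [integral_add (θ.integrable.comp_add_right h).norm θ.integrable.norm,
            integral_add_right_eq_self (fun y => ‖θ y‖) h, two_mul]
      _ ≤ _ := le_add_of_nonneg_right (mul_nonneg (mul_nonneg (by positivity) hM0) hW0)

theorem integral_dilate {n : ℕ} (j : ℤ) (u : Rn n → ℝ) :
    ∫ x, ((2 : ℝ) ^ j) ^ n * u ((2 : ℝ) ^ j • x) = ∫ x, u x := by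
  rw [integral_const_mul, Measure.integral_comp_smul, finrank_euclideanSpace_fin,
    abs_of_pos (by positivity), smul_eq_mul, ← mul_assoc, mul_inv_cancel₀ (by positivity), one_mul]

theorem norm_schwartzDilate {n : ℕ} (j : ℤ) (θ : 𝓢(Rn n, ℂ)) (x : Rn n) :
    ‖schwartzDilate j θ x‖ = ((2 : ℝ) ^ j) ^ n * ‖θ ((2 : ℝ) ^ j • x)‖ := by
  rw [schwartzDilate_apply, norm_smul, Real.norm_of_nonneg (by positivity)]

theorem integral_norm_schwartzDilate {n : ℕ} (j : ℤ) (θ : 𝓢(Rn n, ℂ)) :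
    ∫ x, ‖schwartzDilate j θ x‖ = ∫ x, ‖θ x‖ := by
  simp only [norm_schwartzDilate]
  exact integral_dilate j fun x => ‖θ x‖

theorem integral_norm_schwartzDilate_translate_sub {n : ℕ} (j : ℤ) (θ : 𝓢(Rn n, ℂ)) (h : Rn n) :
    ∫ x, ‖schwartzDilate j θ (x + h) - schwartzDilate j θ x‖ =
      ∫ x, ‖θ (x + (2 : ℝ) ^ j • h) - θ x‖ := by
  simp only [schwartzDilate_apply, ← smul_sub, norm_smul, smul_add]
  have := integral_dilate j fun x => ‖θ (x + (2 : ℝ) ^ j • h) - θ x‖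
  rw [← this]
  congr 1
  ext x
  rw [Real.norm_of_nonneg (by positivity)]

/-- Young's inequality for the convolution with an integrable kernel. -/
theorem eLpNorm_integral_mul_le {n : ℕ} {κ g : Rn n → ℂ} (hκ : Continuous κ) (hg : Continuous g)
    {p : ℝ} (hp : 1 ≤ p) :
    eLpNorm (fun x => ∫ z, κ (x - z) * g z) (ENNReal.ofReal p) volume ≤
      (∫⁻ z, ‖κ z‖ₑ) * eLpNorm g (ENNReal.ofReal p) volume := by
  have hp0 : 0 < p := by linarith
  have hm : Continuous fun q : Rn n × Rn n => κ (q.1 - q.2) := by fun_prop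
  rw [eLpNorm_eq_lintegral_rpow_enorm_toReal (by simpa using hp0) ENNReal.ofReal_ne_top,
    eLpNorm_eq_lintegral_rpow_enorm_toReal (by simpa using hp0) ENNReal.ofReal_ne_top,
    ENNReal.toReal_ofReal hp0.le]
  have h1 : ∫⁻ x, ‖∫ z, κ (x - z) * g z‖ₑ ^ p ≤
      (∫⁻ z, ‖κ z‖ₑ) ^ p * ∫⁻ z, ‖g z‖ₑ ^ p := by
    calc _ ≤ ∫⁻ x, (∫⁻ z, ‖κ (x - z)‖ₑ) ^ (p - 1) * ∫⁻ z, ‖κ (x - z)‖ₑ * ‖g z‖ₑ ^ p := by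
          refine lintegral_mono fun x => ?_
          have hx : Continuous fun z => κ (x - z) := by fun_prop
          refine le_trans ?_ (ENNReal.lintegral_mul_rpow_le hx.enorm.measurable.aemeasurable
            hg.enorm.measurable.aemeasurable hp)
          gcongr
          refine (enorm_integral_le_lintegral_enorm _).trans (le_of_eq ?_)
          simp only [enorm_mul]
      _ = (∫⁻ z, ‖κ z‖ₑ) ^ (p - 1) * ∫⁻ x, ∫⁻ z, ‖κ (x - z)‖ₑ * ‖g z‖ₑ ^ p := by
          simp only [lintegral_sub_left_eq_self fun z => ‖κ z‖ₑ]
          rw [lintegral_const_mul]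
          refine Measurable.lintegral_prod_right' (f := fun q : Rn n × Rn n =>
            ‖κ (q.1 - q.2)‖ₑ * ‖g q.2‖ₑ ^ p) ?_
          exact hm.enorm.measurable.mul ((hg.comp continuous_snd).enorm.measurable.pow_const p)
      _ = (∫⁻ z, ‖κ z‖ₑ) ^ (p - 1) * ((∫⁻ z, ‖κ z‖ₑ) * ∫⁻ z, ‖g z‖ₑ ^ p) := by
          congr 1
          rw [lintegral_lintegral_swap]
          · have : ∀ z : Rn n, ∫⁻ x, ‖κ (x - z)‖ₑ * ‖g z‖ₑ ^ p =
                (∫⁻ x, ‖κ x‖ₑ) * ‖g z‖ₑ ^ p := by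
              intro z
              have hx : Continuous fun x => κ (x - z) := by fun_prop
              rw [lintegral_mul_const _ hx.enorm.measurable,
                lintegral_sub_right_eq_self fun x => ‖κ x‖ₑ]
            simp only [this]
            rw [lintegral_const_mul _ (hg.enorm.measurable.pow_const p)]
          · exact (hm.enorm.measurable.mul
              ((hg.comp continuous_snd).enorm.measurable.pow_const p)).aemeasurable
      _ = _ := by
          rw [← mul_assoc]
          congr 1
          conv_lhs => rw [← ENNReal.rpow_one (∫⁻ z, ‖κ z‖ₑ), ← ENNReal.rpow_mul, one_mul]
          rw [← ENNReal.rpow_add_of_nonneg _ _ (by linarith) zero_le_one, sub_add_cancel]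
  calc _ ≤ ((∫⁻ z, ‖κ z‖ₑ) ^ p * ∫⁻ z, ‖g z‖ₑ ^ p) ^ (1 / p) := by gcongr
    _ = _ := by
      rw [ENNReal.mul_rpow_of_nonneg _ _ (by positivity), ← ENNReal.rpow_mul,
        mul_one_div_cancel hp0.ne', ENNReal.rpow_one]

/-- Jensen's inequality with weight `‖κ‖`, then the remaining factor `‖κ‖` bounded by `S`. It
replaces Hölder's inequality with the conjugate exponent and includes `p = 1`. -/
theorem lintegral_enorm_mul_le {n : ℕ} {κ g : Rn n → ℂ} (hκ : Continuous κ) (hg : Continuous g)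
    {p S : ℝ} (hp : 1 ≤ p) (hS : ∀ z, ‖κ z‖ ≤ S) :
    ∫⁻ z, ‖κ z‖ₑ * ‖g z‖ₑ ≤
      ((∫⁻ z, ‖κ z‖ₑ) ^ (p - 1) * ENNReal.ofReal S) ^ (1 / p) *
        eLpNorm g (ENNReal.ofReal p) volume := by
  have hp0 : 0 < p := by linarith
  rw [eLpNorm_eq_lintegral_rpow_enorm_toReal (by simpa using hp0) ENNReal.ofReal_ne_top,
    ENNReal.toReal_ofReal hp0.le, ← ENNReal.mul_rpow_of_nonneg _ _ (by positivity),
    one_div, ENNReal.le_rpow_inv_iff hp0]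
  refine (ENNReal.lintegral_mul_rpow_le hκ.enorm.measurable.aemeasurable
    hg.enorm.measurable.aemeasurable hp).trans ?_
  rw [mul_assoc, ← lintegral_const_mul _ (hg.enorm.measurable.pow_const p)]
  gcongr with z
  rw [← ofReal_norm]
  exact ENNReal.ofReal_le_ofReal (hS z)

/-- Bernstein inequalities for functions reproduced by the dilates of a fixed Schwartz kernel. -/
theorem exists_bernstein_const {n : ℕ} (θ : 𝓢(Rn n, ℂ)) {p : ℝ} (hp : 1 ≤ p) :
    ∃ C : ℝ, 0 ≤ C ∧ ∀ (j : ℤ) (g : Rn n → ℂ), Continuous g →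
      eLpNorm g (ENNReal.ofReal p) volume ≠ ⊤ →
      (∀ x, ∫ z, schwartzDilate j θ (x - z) * g z = g x) →
      (∀ x, ‖g x‖ ≤ C * (2 : ℝ) ^ (j * (n / p) : ℝ) *
        (eLpNorm g (ENNReal.ofReal p) volume).toReal) ∧
      (∀ x h, ‖g (x + h) - g x‖ ≤ C * min 1 ((2 : ℝ) ^ j * ‖h‖) * ((2 : ℝ) ^ (j * (n / p) : ℝ) *
        (eLpNorm g (ENNReal.ofReal p) volume).toReal)) ∧
      (∀ h, eLpNorm (fun x => g (x + h) - g x) (ENNReal.ofReal p) volume ≤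
        ENNReal.ofReal (C * min 1 ((2 : ℝ) ^ j * ‖h‖) *
          (eLpNorm g (ENNReal.ofReal p) volume).toReal)) := by
  have hp0 : 0 < p := by linarith
  obtain ⟨D, hD, hdiff⟩ := θ.exists_integral_norm_translate_sub_le
  set A : ℝ := ∫ x, ‖θ x‖ with hA
  have hA0 : 0 ≤ A := integral_nonneg fun _ => norm_nonneg _
  set S : ℝ := SchwartzMap.seminorm ℂ 0 0 θ with hS
  have hS0 : 0 ≤ S := apply_nonneg _ _
  -- The dilated kernel has `L¹` norm `A` and sup norm at most `2^{jn} S`; the power `1 / p`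
  -- produces `B 2^{jn/p}`. The three bounds hold with constants `B`, `D * B` and `D`.
  set B : ℝ := (A ^ (p - 1) * S) ^ (1 / p) with hB
  have hB0 : 0 ≤ B := by positivity
  refine ⟨B + D + D * B, by positivity, fun j g hg hfin hrep => ?_⟩
  set N : ℝ := (eLpNorm g (ENNReal.ofReal p) volume).toReal with hN
  have hNe : eLpNorm g (ENNReal.ofReal p) volume = ENNReal.ofReal N :=
    (ENNReal.ofReal_toReal hfin).symm
  have hN0 : 0 ≤ N := ENNReal.toReal_nonneg
  set K : 𝓢(Rn n, ℂ) := schwartzDilate j θ with hK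
  have hbd : ∀ x, ∫⁻ z, ‖K (x - z)‖ₑ * ‖g z‖ₑ ≤
      ENNReal.ofReal (B * (2 : ℝ) ^ (j * (n / p) : ℝ) * N) := by
    intro x
    have hsup : ∀ z, ‖K (x - z)‖ ≤ ((2 : ℝ) ^ j) ^ n * S := by
      intro z
      rw [hK, norm_schwartzDilate]
      gcongr
      exact SchwartzMap.norm_le_seminorm ℂ θ _
    have hc : Continuous fun z => K (x - z) := by fun_prop
    refine (lintegral_enorm_mul_le hc hg hp hsup).trans (le_of_eq ?_)
    rw [lintegral_sub_left_eq_self fun z => ‖K z‖ₑ, ← ofReal_integral_norm_eq_lintegral_enorm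
      K.integrable, hK, integral_norm_schwartzDilate, hNe,
      ENNReal.ofReal_rpow_of_nonneg hA0 (by linarith), ← ENNReal.ofReal_mul (by positivity),
      ENNReal.ofReal_rpow_of_nonneg (by positivity) (by positivity),
      ← ENNReal.ofReal_mul (by positivity)]
    congr 2
    have : (((2 : ℝ) ^ j) ^ n) ^ (1 / p) = (2 : ℝ) ^ (j * (n / p) : ℝ) := by
      rw [← Real.rpow_intCast, ← Real.rpow_natCast, ← Real.rpow_mul zero_le_two,
        ← Real.rpow_mul zero_le_two]
      congr 1
      ring
    rw [mul_left_comm, Real.mul_rpow (by positivity) (by positivity), this, mul_comm]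
  have hint : ∀ x, Integrable fun z => K (x - z) * g z := by
    intro x
    have hc : Continuous fun z => K (x - z) * g z := by fun_prop
    refine ⟨hc.aestronglyMeasurable, ?_⟩
    rw [HasFiniteIntegral]
    simp only [enorm_mul]
    exact (hbd x).trans_lt ENNReal.ofReal_lt_top
  have h1 : ∀ x, ‖g x‖ ≤ B * (2 : ℝ) ^ (j * (n / p) : ℝ) * N := by
    intro x
    rw [← ENNReal.ofReal_le_ofReal_iff (by positivity), ofReal_norm]
    refine le_trans ?_ (hbd x)
    conv_lhs => rw [← hrep x]
    refine (enorm_integral_le_lintegral_enorm _).trans (le_of_eq ?_)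
    simp only [enorm_mul, hK]
  have hκ : ∀ h, ∫ z, ‖K (z + h) - K z‖ ≤ D * min 1 ((2 : ℝ) ^ j * ‖h‖) := by
    intro h
    rw [hK, integral_norm_schwartzDilate_translate_sub]
    refine (hdiff _).trans (le_of_eq ?_)
    rw [norm_smul, Real.norm_of_nonneg (by positivity)]
  have hκi : ∀ h, Integrable fun z => K (z + h) - K z := fun h =>
    (K.integrable.comp_add_right h).sub K.integrable
  -- The difference is moved onto the kernel, whose `L¹` modulus of continuity is known.
  have hdrep : ∀ h x, g (x + h) - g x = ∫ z, (K (x - z + h) - K (x - z)) * g z := by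
    intro h x
    simp only [sub_mul]
    have e : ∀ z, x - z + h = x + h - z := fun z => by abel
    simp only [e]
    rw [integral_sub (hint _) (hint _), hK, hrep, hrep]
  refine ⟨fun x => (h1 x).trans ?_, fun x h => ?_, fun h => ?_⟩
  · gcongr
    have : 0 ≤ D * B := by positivity
    linarith
  · rw [hdrep]
    calc _ ≤ ∫ z, ‖K (x - z + h) - K (x - z)‖ * (B * (2 : ℝ) ^ (j * (n / p) : ℝ) * N) := by
          refine (norm_integral_le_integral_norm _).trans ?_
          refine integral_mono_of_nonneg (Eventually.of_forall fun _ => norm_nonneg _)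
            (((hκi h).comp_sub_left x).norm.mul_const _) (Eventually.of_forall fun z => ?_)
          dsimp only
          rw [norm_mul]
          gcongr
          exact h1 z
      _ = (∫ z, ‖K (z + h) - K z‖) * (B * (2 : ℝ) ^ (j * (n / p) : ℝ) * N) := by
          rw [integral_mul_const, integral_sub_left_eq_self fun z => ‖K (z + h) - K z‖]
      _ ≤ D * min 1 ((2 : ℝ) ^ j * ‖h‖) * (B * (2 : ℝ) ^ (j * (n / p) : ℝ) * N) := by
          gcongr; exact hκ h
      _ = (D * B) * min 1 ((2 : ℝ) ^ j * ‖h‖) * ((2 : ℝ) ^ (j * (n / p) : ℝ) * N) := by ring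
      _ ≤ _ := by gcongr; linarith
  · have hc : Continuous fun z => K (z + h) - K z := by fun_prop
    simp only [hdrep h]
    refine (eLpNorm_integral_mul_le hc hg hp).trans ?_
    rw [← ofReal_integral_norm_eq_lintegral_enorm (hκi h), hNe, ← ENNReal.ofReal_mul
      (integral_nonneg fun _ => norm_nonneg _)]
    apply ENNReal.ofReal_le_ofReal
    refine mul_le_mul_of_nonneg_right ((hκ h).trans ?_) hN0
    gcongr
    have : 0 ≤ D * B := by positivity
    linarith

/-! ### Dyadic sums -/

/-- The function `min(1, t) t^{-γ}`. -/
noncomputable def dyadicKernel (γ t : ℝ) : ℝ := min 1 t * t ^ (-γ)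

theorem dyadicKernel_nonneg {γ t : ℝ} (ht : 0 ≤ t) : 0 ≤ dyadicKernel γ t :=
  mul_nonneg (le_min zero_le_one ht) (Real.rpow_nonneg ht _)

/-- Extracts the size `t^γ`, leaving a factor that depends only on the product `2ʲ t`. -/
theorem min_mul_eq_dyadicKernel (γ : ℝ) (j : ℤ) {t : ℝ} (ht : 0 < t) :
    min 1 ((2 : ℝ) ^ j * t) * (2 : ℝ) ^ (-(j * γ) : ℝ) =
      dyadicKernel γ ((2 : ℝ) ^ j * t) * t ^ γ := by
  have : ((2 : ℝ) ^ j * t) ^ (-γ) = (2 : ℝ) ^ (-(j * γ) : ℝ) * t ^ (-γ) := by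
    rw [Real.mul_rpow (by positivity) ht.le, ← Real.rpow_intCast, ← Real.rpow_mul zero_le_two,
      mul_neg]
  rw [dyadicKernel, this, mul_assoc, mul_assoc, ← Real.rpow_add ht, neg_add_cancel, Real.rpow_zero,
    mul_one]

/-- The kernel is `t^{1-γ}` below one and `t^{-γ}` above, so `0 < γ < 1` gives geometric decay on
both sides. The factor two absorbs `2^{1-γ}` from the upper endpoint. -/
theorem dyadicKernel_le {γ : ℝ} (h0 : 0 < γ) (h1 : γ < 1) {i : ℤ} {u : ℝ} (hu : (2 : ℝ) ^ i ≤ u)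
    (hu' : u < (2 : ℝ) ^ (i + 1)) :
    dyadicKernel γ u ≤ 2 * (max ((2 : ℝ) ^ (-γ)) ((2 : ℝ) ^ (γ - 1))) ^ i.natAbs := by
  have hi : (0 : ℝ) < (2 : ℝ) ^ i := by positivity
  have hu0 : 0 < u := hi.trans_le hu
  have hρ : 0 ≤ max ((2 : ℝ) ^ (-γ)) ((2 : ℝ) ^ (γ - 1)) := le_max_of_le_left (by positivity)
  rcases le_or_gt 0 i with h | h
  · obtain ⟨m, rfl⟩ := Int.eq_ofNat_of_zero_le h
    calc dyadicKernel γ u ≤ 1 * u ^ (-γ) := by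
          rw [dyadicKernel]; gcongr; exact min_le_left _ _
      _ ≤ 1 * ((2 : ℝ) ^ (m : ℤ)) ^ (-γ) := by
          rw [one_mul, one_mul]
          exact Real.rpow_le_rpow_of_nonpos hi hu (by linarith)
      _ = ((2 : ℝ) ^ (-γ)) ^ m := by
          rw [one_mul, zpow_natCast, ← Real.rpow_natCast, ← Real.rpow_natCast,
            ← Real.rpow_mul zero_le_two, ← Real.rpow_mul zero_le_two, mul_comm]
      _ ≤ (max ((2 : ℝ) ^ (-γ)) ((2 : ℝ) ^ (γ - 1))) ^ m := by gcongr; exact le_max_left _ _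
      _ ≤ _ := by
          rw [Int.natAbs_natCast]
          exact le_mul_of_one_le_left (pow_nonneg hρ _) one_le_two
  · obtain ⟨m, hm⟩ := Int.eq_ofNat_of_zero_le (show 0 ≤ -i by omega)
    obtain rfl : i = -(m : ℤ) := by omega
    calc dyadicKernel γ u ≤ u * u ^ (-γ) := by
          rw [dyadicKernel]; gcongr; exact min_le_right _ _
      _ = u ^ (1 - γ) := by rw [sub_eq_add_neg, Real.rpow_add hu0, Real.rpow_one]
      _ ≤ ((2 : ℝ) ^ (-(m : ℤ) + 1)) ^ (1 - γ) := by gcongr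
      _ = (2 : ℝ) ^ (1 - γ) * ((2 : ℝ) ^ (γ - 1)) ^ m := by
          rw [← Real.rpow_intCast, ← Real.rpow_natCast, ← Real.rpow_mul zero_le_two,
            ← Real.rpow_mul zero_le_two, ← Real.rpow_add two_pos]
          push_cast
          congr 1
          ring
      _ ≤ (2 : ℝ) ^ (1 : ℝ) * (max ((2 : ℝ) ^ (-γ)) ((2 : ℝ) ^ (γ - 1))) ^ m := by
          gcongr
          · exact one_le_two
          · linarith
          · exact le_max_right _ _
      _ = _ := by rw [Real.rpow_one, Int.natAbs_neg, Int.natAbs_natCast]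

theorem exists_tsum_dyadicKernel_le {γ : ℝ} (h0 : 0 < γ) (h1 : γ < 1) :
    ∃ C : ℝ, 0 ≤ C ∧ ∀ t : ℝ, 0 < t → Summable (fun j : ℤ => dyadicKernel γ ((2 : ℝ) ^ j * t)) ∧
      ∑' j : ℤ, dyadicKernel γ ((2 : ℝ) ^ j * t) ≤ C := by
  set ρ : ℝ := max ((2 : ℝ) ^ (-γ)) ((2 : ℝ) ^ (γ - 1)) with hρ
  have hρ0 : 0 ≤ ρ := le_max_of_le_left (by positivity)
  have hρ1 : ρ < 1 := max_lt (Real.rpow_lt_one_of_one_lt_of_neg one_lt_two (by linarith))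
    (Real.rpow_lt_one_of_one_lt_of_neg one_lt_two (by linarith))
  have hs : Summable fun j : ℤ => 2 * ρ ^ j.natAbs := (summable_pow_natAbs hρ0 hρ1).mul_left 2
  refine ⟨∑' j : ℤ, 2 * ρ ^ j.natAbs, tsum_nonneg fun _ => by positivity, fun t ht => ?_⟩
  -- Replacing `t` by its dyadic scale `2ᵐ` only shifts the summation index, so the bound is uniform
  -- in `t`.
  obtain ⟨m, hm1, hm2⟩ := exists_mem_Ico_zpow ht (one_lt_two : (1 : ℝ) < 2)
  have hle : ∀ j : ℤ, dyadicKernel γ ((2 : ℝ) ^ j * t) ≤ 2 * ρ ^ (j + m).natAbs := by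
    intro j
    have hj : (0 : ℝ) < (2 : ℝ) ^ j := by positivity
    refine dyadicKernel_le h0 h1 (i := j + m) ?_ ?_
    · rw [zpow_add₀ two_ne_zero]; gcongr
    · rw [add_assoc, zpow_add₀ two_ne_zero]; gcongr
  have hs' : Summable fun j : ℤ => 2 * ρ ^ (j + m).natAbs :=
    (Equiv.addRight m).summable_iff.2 hs
  have hsum : Summable (fun j : ℤ => dyadicKernel γ ((2 : ℝ) ^ j * t)) :=
    Summable.of_nonneg_of_le (fun j => dyadicKernel_nonneg (by positivity)) hle hs'
  refine ⟨hsum, (hsum.tsum_le_tsum hle hs').trans_eq ?_⟩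
  exact (Equiv.addRight m).tsum_eq fun j : ℤ => 2 * ρ ^ j.natAbs

/-! ### The Hölder continuous representative -/

/-- The sum of the functions `g_j`, each normalized to vanish at the origin. -/
noncomputable def pieceSum {n : ℕ} (g : ℤ → Rn n → ℂ) (x : Rn n) : ℂ := ∑' j, (g j x - g j 0)

theorem exists_tsum_increment_le {n : ℕ} {g : ℤ → Rn n → ℂ} {b : ℤ → ℝ} {C A σ : ℝ} (hC : 0 ≤ C)
    (hb0 : ∀ j, 0 ≤ b j) (hbA : ∀ j, b j ≤ A) (h0 : 0 < σ) (h1 : σ < 1)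
    (hg : ∀ j x h, ‖g j (x + h) - g j x‖ ≤
      C * min 1 ((2 : ℝ) ^ j * ‖h‖) * ((2 : ℝ) ^ (-(j * σ) : ℝ) * b j)) :
    ∃ M : ℝ, 0 ≤ M ∧ ∀ x h, Summable (fun j => ‖g j (x + h) - g j x‖) ∧
      ∑' j, ‖g j (x + h) - g j x‖ ≤ M * ‖h‖ ^ σ := by
  obtain ⟨D, hD, hsum⟩ := exists_tsum_dyadicKernel_le h0 h1
  have hA : 0 ≤ A := (hb0 0).trans (hbA 0)
  refine ⟨C * A * D, by positivity, fun x h => ?_⟩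
  rcases eq_or_ne h 0 with rfl | hh
  · simp [Real.zero_rpow h0.ne', summable_zero]
  · have hh' : 0 < ‖h‖ := norm_pos_iff.2 hh
    obtain ⟨hs, hle⟩ := hsum ‖h‖ hh'
    have hbd : ∀ j, ‖g j (x + h) - g j x‖ ≤
        C * A * ‖h‖ ^ σ * dyadicKernel σ ((2 : ℝ) ^ j * ‖h‖) := by
      intro j
      refine (hg j x h).trans ?_
      calc _ = C * (min 1 ((2 : ℝ) ^ j * ‖h‖) * (2 : ℝ) ^ (-(j * σ) : ℝ)) * b j := by ring
        _ = C * (dyadicKernel σ ((2 : ℝ) ^ j * ‖h‖) * ‖h‖ ^ σ) * b j := by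
          rw [min_mul_eq_dyadicKernel _ _ hh']
        _ ≤ C * (dyadicKernel σ ((2 : ℝ) ^ j * ‖h‖) * ‖h‖ ^ σ) * A := by
          have := dyadicKernel_nonneg (γ := σ) (t := (2 : ℝ) ^ j * ‖h‖) (by positivity)
          gcongr
          exact hbA j
        _ = _ := by ring
    have hs' := hs.mul_left (C * A * ‖h‖ ^ σ)
    have hs'' := Summable.of_nonneg_of_le (fun _ => norm_nonneg _) hbd hs'
    refine ⟨hs'', (hs''.tsum_le_tsum hbd hs').trans ?_⟩
    rw [tsum_mul_left]
    calc _ ≤ C * A * ‖h‖ ^ σ * D := by gcongr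
      _ = _ := by ring

section

variable {n : ℕ} {g : ℤ → Rn n → ℂ} {M σ : ℝ}

theorem pieceSum_sub (hM : ∀ x h, Summable (fun j => ‖g j (x + h) - g j x‖) ∧
      ∑' j, ‖g j (x + h) - g j x‖ ≤ M * ‖h‖ ^ σ) (x h : Rn n) :
    pieceSum g (x + h) - pieceSum g x = ∑' j, (g j (x + h) - g j x) := by
  have hs : ∀ x, Summable fun j => g j x - g j 0 := fun x => by
    simpa using (hM 0 x).1.of_norm
  rw [pieceSum, pieceSum, ← (hs _).tsum_sub (hs _)]
  simp

theorem norm_pieceSum_sub_le (hM : ∀ x h, Summable (fun j => ‖g j (x + h) - g j x‖) ∧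
      ∑' j, ‖g j (x + h) - g j x‖ ≤ M * ‖h‖ ^ σ) (x h : Rn n) :
    ‖pieceSum g (x + h) - pieceSum g x‖ ≤ M * ‖h‖ ^ σ := by
  rw [pieceSum_sub hM]
  exact (norm_tsum_le_tsum_norm (hM x h).1).trans (hM x h).2

theorem continuous_pieceSum (h0 : 0 < σ) (hM : ∀ x h, Summable (fun j => ‖g j (x + h) - g j x‖) ∧
      ∑' j, ‖g j (x + h) - g j x‖ ≤ M * ‖h‖ ^ σ) : Continuous (pieceSum g) := by
  rw [continuous_iff_continuousAt]
  intro x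
  rw [ContinuousAt, tendsto_iff_norm_sub_tendsto_zero]
  have ht : Tendsto (fun y => M * ‖y - x‖ ^ σ) (𝓝 x) (𝓝 0) := by
    have : Continuous fun y : Rn n => M * ‖y - x‖ ^ σ :=
      continuous_const.mul ((by fun_prop : Continuous fun y : Rn n => ‖y - x‖).rpow_const
        fun _ => Or.inr h0.le)
    simpa [Real.zero_rpow h0.ne'] using this.tendsto x
  refine squeeze_zero (fun _ => norm_nonneg _) (fun y => ?_) ht
  simpa using norm_pieceSum_sub_le hM x (y - x)

theorem integrable_norm_rpow_mul (h0 : 0 < σ) (h1 : σ < 1) (φ : 𝓢(Rn n, ℂ)) :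
    Integrable fun x => ‖x‖ ^ σ * ‖φ x‖ := by
  have hb : Integrable fun x => ‖φ x‖ + ‖x‖ ^ 1 * ‖φ x‖ :=
    φ.integrable.norm.add (φ.integrable_pow_mul volume 1)
  have hc : Continuous fun x : Rn n => ‖x‖ ^ σ * ‖φ x‖ :=
    (continuous_norm.rpow_const fun _ => Or.inr h0.le).mul φ.continuous.norm
  refine hb.mono' hc.aestronglyMeasurable (Eventually.of_forall fun x => ?_)
  rw [Real.norm_of_nonneg (by positivity), ← one_add_mul, pow_one]
  gcongr
  rcases le_or_gt ‖x‖ 1 with h | h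
  · exact (Real.rpow_le_one (norm_nonneg _) h h0.le).trans (by linarith [norm_nonneg x])
  · calc ‖x‖ ^ σ ≤ ‖x‖ ^ (1 : ℝ) := Real.rpow_le_rpow_of_exponent_le h.le h1.le
      _ ≤ _ := by rw [Real.rpow_one]; linarith

/-- The series is dominated by `M ‖x‖^σ`, integrable against `φ`, so it integrates termwise. The
constants `g j 0` drop out because `φ` has integral zero; boundedness of each `g j` allows splitting
them off. -/
theorem isRepresentative_pieceSum {f : SchwartzZeroDual n} (h0 : 0 < σ) (h1 : σ < 1)
    (hM : ∀ x h, Summable (fun j => ‖g j (x + h) - g j x‖) ∧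
      ∑' j, ‖g j (x + h) - g j x‖ ≤ M * ‖h‖ ^ σ)
    (hc : ∀ j, Continuous (g j)) (hbd : ∀ j, ∃ B, ∀ x, ‖g j x‖ ≤ B)
    (hf : ∀ φ : schwartzZero n, HasSum (fun j => ∫ x, φ.1 x * g j x) (f φ)) :
    IsRepresentative (pieceSum g) f := by
  intro φ
  have hM' : ∀ x, Summable (fun j => ‖g j x - g j 0‖) ∧
      ∑' j, ‖g j x - g j 0‖ ≤ M * ‖x‖ ^ σ := fun x => by simpa using hM 0 x
  have hFc := continuous_pieceSum h0 hM
  have hI := (integrable_norm_rpow_mul h0 h1 φ.1).const_mul M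
  constructor
  · refine hI.mono' (hFc.mul φ.1.continuous).aestronglyMeasurable (Eventually.of_forall fun x => ?_)
    rw [norm_mul, ← mul_assoc]
    gcongr
    exact (norm_tsum_le_tsum_norm (hM' x).1).trans (hM' x).2
  · have hmeas : ∀ j, Continuous fun x => (g j x - g j 0) * φ.1 x := fun j =>
      ((hc j).sub continuous_const).mul φ.1.continuous
    have hfin : ∑' j, ∫⁻ x, ‖(g j x - g j 0) * φ.1 x‖ₑ ≠ ⊤ := by
      rw [← lintegral_tsum fun j => (hmeas j).enorm.measurable.aemeasurable]
      refine ((lintegral_mono fun x => ?_).trans_lt hI.lintegral_lt_top).ne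
      simp only [enorm_mul, ENNReal.tsum_mul_right]
      rw [← mul_assoc, ENNReal.ofReal_mul' (norm_nonneg _), ofReal_norm]
      gcongr
      simp only [← ofReal_norm]
      rw [← ENNReal.ofReal_tsum_of_nonneg (fun _ => norm_nonneg _) (hM' x).1]
      exact ENNReal.ofReal_le_ofReal (hM' x).2
    have h3 := integral_tsum (fun j => (hmeas j).aestronglyMeasurable) hfin
    simp only [pieceSum, ← tsum_mul_right]
    rw [h3, ← (hf φ).tsum_eq]
    congr 1
    ext j
    obtain ⟨B, hB⟩ := hbd j
    have hi : Integrable fun x => φ.1 x * g j x :=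
      φ.1.integrable.mul_bdd (c := B) (hc j).aestronglyMeasurable (Eventually.of_forall hB)
    have e : ∀ x, (g j x - g j 0) * φ.1 x = φ.1 x * g j x - g j 0 * φ.1 x := fun x => by ring
    simp only [e]
    rw [integral_sub hi (φ.1.integrable.const_mul _), integral_const_mul]
    have hz : ∫ x, φ.1 x = 0 := by simpa using φ.2 0
    rw [hz, mul_zero, sub_zero]

/-- Fatou's lemma along symmetric partial sums extends the finite triangle inequality to the series.
-/
theorem eLpNorm_pieceSum_sub_le {p : ℝ≥0∞} (hp : 1 ≤ p)
    (hM : ∀ x h, Summable (fun j => ‖g j (x + h) - g j x‖) ∧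
      ∑' j, ‖g j (x + h) - g j x‖ ≤ M * ‖h‖ ^ σ) (hc : ∀ j, Continuous (g j)) (h : Rn n) :
    eLpNorm (fun x => pieceSum g (x + h) - pieceSum g x) p volume ≤
      ∑' j, eLpNorm (fun x => g j (x + h) - g j x) p volume := by
  have hm : ∀ j, AEStronglyMeasurable (fun x => g j (x + h) - g j x) volume := fun j =>
    (((hc j).comp (continuous_add_const h)).sub (hc j)).aestronglyMeasurable
  refine (Lp.eLpNorm_lim_le_liminf_eLpNorm
    (f := fun N : ℕ => ∑ j ∈ Finset.Icc (-(N : ℤ)) N, fun x => g j (x + h) - g j x)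
    (fun N => Finset.aestronglyMeasurable_sum _ fun j _ => hm j) _
    (Eventually.of_forall fun x => ?_)).trans ?_
  · have := ((hM x h).1.of_norm.hasSum).comp (Finset.tendsto_Icc_neg (R := ℤ))
    rw [pieceSum_sub hM]
    simpa [Function.comp_def, Finset.sum_apply] using this
  · refine liminf_le_of_frequently_le' (Frequently.of_forall fun N => ?_)
    exact (eLpNorm_sum_le (fun j _ => hm j) hp).trans (ENNReal.sum_le_tsum _)

end

/-! ### Radial integrals -/

/-- Homogeneity reduces to the unit ball, where `a > 0` makes the singularity integrable. -/
theorem lintegral_closedBall_rpow_le {n : ℕ} (hn : 0 < n) {a : ℝ} (ha : 0 < a) :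
    ∃ c : ℝ, 0 ≤ c ∧ ∀ ρ : ℝ, 0 < ρ →
      ∫⁻ h in Metric.closedBall (0 : Rn n) ρ, ENNReal.ofReal (‖h‖ ^ (a - n)) ≤
        ENNReal.ofReal (c * ρ ^ a) := by
  have : Nonempty (Fin n) := ⟨⟨0, hn⟩⟩
  let u : ℝ → Rn n → ℝ := fun ρ => (Metric.closedBall (0 : Rn n) ρ).indicator fun h => ‖h‖ ^ (a - n)
  have hscale : ∀ ρ : ℝ, 0 < ρ → ∀ h, u ρ (ρ • h) = ρ ^ (a - n) * u 1 h := by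
    intro ρ hρ h
    have hiff : ρ • h ∈ Metric.closedBall (0 : Rn n) ρ ↔ h ∈ Metric.closedBall (0 : Rn n) 1 := by
      rw [mem_closedBall_zero_iff, mem_closedBall_zero_iff, norm_smul, Real.norm_of_nonneg hρ.le,
        mul_le_iff_le_one_right hρ]
    by_cases hh : h ∈ Metric.closedBall (0 : Rn n) 1
    · simp only [u]
      rw [Set.indicator_of_mem hh, Set.indicator_of_mem (hiff.2 hh), norm_smul,
        Real.norm_of_nonneg hρ.le, Real.mul_rpow hρ.le (norm_nonneg _)]
    · simp only [u]
      rw [Set.indicator_of_notMem hh, Set.indicator_of_notMem (fun h' => hh (hiff.1 h')), mul_zero]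
  have hu0 : ∀ ρ h, 0 ≤ u ρ h := fun ρ h => Set.indicator_nonneg (fun _ _ => by positivity) h
  have hint1 : Integrable (u 1) := by
    have hball : IntegrableOn (fun h : Rn n => ‖h‖ ^ (a - n)) (Metric.ball 0 2) := by
      rw [integrableOn_fun_norm_addHaar (volume : Measure (Rn n)) (f := fun t => t ^ (a - n)),
        finrank_euclideanSpace_fin]
      have : IntegrableOn (fun t : ℝ => t ^ (a - 1)) (Set.Ioo 0 2) volume :=
        (intervalIntegral.integrableOn_Ioo_rpow_iff two_pos).2 (by linarith)
      refine this.congr_fun (fun t ht => ?_) measurableSet_Ioo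
      simp only [smul_eq_mul]
      rw [← Real.rpow_natCast, ← Real.rpow_add ht.1, Nat.cast_sub (by omega)]
      congr 1
      push_cast
      ring
    exact (hball.mono_set (Metric.closedBall_subset_ball (by norm_num))).integrable_indicator
      measurableSet_closedBall
  have hint : ∀ ρ : ℝ, 0 < ρ → Integrable (u ρ) := by
    intro ρ hρ
    rw [← integrable_comp_smul_iff volume (u ρ) hρ.ne']
    simp only [hscale ρ hρ]
    exact hint1.const_mul _
  refine ⟨∫ h, u 1 h, integral_nonneg (hu0 1), fun ρ hρ => ?_⟩
  have h1 : ∫ h, u ρ h = (∫ h, u 1 h) * ρ ^ a := by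
    have := Measure.integral_comp_smul (volume : Measure (Rn n)) (u ρ) ρ
    simp only [hscale ρ hρ] at this
    rw [integral_const_mul, finrank_euclideanSpace_fin, abs_of_pos (by positivity), smul_eq_mul,
      eq_inv_mul_iff_mul_eq₀ (by positivity)] at this
    rw [← this, ← Real.rpow_natCast, ← mul_assoc, ← Real.rpow_add hρ, add_sub_cancel, mul_comm]
  rw [← h1, ofReal_integral_eq_lintegral_ofReal (hint ρ hρ) (Eventually.of_forall (hu0 ρ)),
    ← lintegral_indicator measurableSet_closedBall]
  refine lintegral_mono fun h => ?_
  by_cases hh : h ∈ Metric.closedBall (0 : Rn n) ρ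
  · simp only [u]; rw [Set.indicator_of_mem hh, Set.indicator_of_mem hh]
  · rw [Set.indicator_of_notMem hh]; exact zero_le

/-- The measure `‖h‖^{-n} dh` is dilation invariant, so the integral is independent of `j`. In polar
coordinates it converges like `t^{-γ} dt` at zero and `t^{-γ-1} dt` at infinity. -/
theorem lintegral_dyadicKernel_le {n : ℕ} (hn : 0 < n) {γ : ℝ} (h0 : 0 < γ) (h1 : γ < 1) :
    ∃ c : ℝ, 0 ≤ c ∧ ∀ j : ℤ,
      ∫⁻ h : Rn n, ENNReal.ofReal (‖h‖ ^ (-(n : ℝ)) * dyadicKernel γ ((2 : ℝ) ^ j * ‖h‖)) ≤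
        ENNReal.ofReal c := by
  have : Nonempty (Fin n) := ⟨⟨0, hn⟩⟩
  let u : Rn n → ℝ := fun h => ‖h‖ ^ (-(n : ℝ)) * dyadicKernel γ ‖h‖
  have hu0 : ∀ h, 0 ≤ u h := fun h =>
    mul_nonneg (by positivity) (dyadicKernel_nonneg (norm_nonneg _))
  have hint : Integrable u := by
    have h2 := integrable_fun_norm_addHaar (volume : Measure (Rn n))
      (f := fun t => t ^ (-(n : ℝ)) * dyadicKernel γ t)
    refine h2.2 ?_
    rw [finrank_euclideanSpace_fin, ← Set.Ioc_union_Ioi_eq_Ioi zero_le_one]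
    refine IntegrableOn.union ?_ ?_
    · have : IntegrableOn (fun t : ℝ => t ^ (-γ)) (Set.Ioc 0 1) volume :=
        (intervalIntegrable_iff_integrableOn_Ioc_of_le zero_le_one).1
          (intervalIntegral.intervalIntegrable_rpow' (by linarith))
      refine this.congr_fun (fun t ht => ?_) measurableSet_Ioc
      simp only [smul_eq_mul, dyadicKernel]
      rw [min_eq_right ht.2, ← mul_assoc, ← mul_assoc, ← Real.rpow_natCast, ← Real.rpow_add ht.1]
      nth_rewrite 3 [← Real.rpow_one t]
      rw [← Real.rpow_add ht.1, ← Real.rpow_add ht.1, Nat.cast_sub (by omega)]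
      congr 1
      push_cast
      ring
    · have : IntegrableOn (fun t : ℝ => t ^ (-γ - 1)) (Set.Ioi 1) volume :=
        integrableOn_Ioi_rpow_of_lt (by linarith) one_pos
      refine this.congr_fun (fun t ht => ?_) measurableSet_Ioi
      have ht' : (1 : ℝ) < t := ht
      have ht0 : 0 < t := by linarith
      simp only [smul_eq_mul, dyadicKernel]
      rw [min_eq_left ht'.le, one_mul, ← mul_assoc, ← Real.rpow_natCast, ← Real.rpow_add ht0,
        ← Real.rpow_add ht0, Nat.cast_sub (by omega)]
      congr 1
      push_cast
      ring
  refine ⟨∫ h, u h, integral_nonneg hu0, fun j => le_of_eq ?_⟩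
  have hj : (0 : ℝ) < (2 : ℝ) ^ j := by positivity
  have e : ∀ h : Rn n, ‖h‖ ^ (-(n : ℝ)) * dyadicKernel γ ((2 : ℝ) ^ j * ‖h‖) =
      ((2 : ℝ) ^ j) ^ n * u ((2 : ℝ) ^ j • h) := by
    intro h
    simp only [u]
    rw [norm_smul, Real.norm_of_nonneg hj.le, Real.mul_rpow hj.le (norm_nonneg _),
      Real.rpow_neg hj.le, Real.rpow_natCast, ← mul_assoc, ← mul_assoc,
      mul_inv_cancel₀ (by positivity), one_mul]
  simp only [e]
  rw [← ofReal_integral_eq_lintegral_ofReal, integral_dilate]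
  · exact (hint.comp_smul hj.ne').const_mul _
  · exact Eventually.of_forall fun h => mul_nonneg (by positivity) (hu0 _)

/-! ### Estimates of the `Q_α^β` norm -/

/-- The weighted Jensen inequality for the counting measure. -/
theorem ENNReal.tsum_mul_sq_le (k v : ℤ → ℝ≥0∞) :
    (∑' j, k j * v j) ^ (2 : ℝ) ≤ (∑' j, k j) * ∑' j, k j * v j ^ (2 : ℝ) := by
  have h := ENNReal.lintegral_mul_rpow_le (μ := Measure.count) (k := k) (v := v)
    (measurable_of_countable _).aemeasurable (measurable_of_countable _).aemeasurable one_le_two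
  simp only [lintegral_count] at h
  convert h using 2
  rw [show (2 : ℝ) - 1 = 1 by norm_num, ENNReal.rpow_one]

theorem cube_subset_closedBall {n : ℕ} (a : Rn n) (l : ℝ) :
    cube a l ⊆ Metric.closedBall a (n * l) := by
  intro x hx
  rw [mem_closedBall_iff_norm]
  have h1 : ‖x - a‖ ≤ ∑ i, ‖(x - a) i‖ := by
    rw [EuclideanSpace.norm_eq]
    exact Real.sqrt_le_iff.2 ⟨Finset.sum_nonneg fun _ _ => norm_nonneg _,
      Finset.sum_sq_le_sq_sum_of_nonneg fun _ _ => norm_nonneg _⟩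
  refine h1.trans ?_
  calc _ ≤ ∑ _i : Fin n, l := by
        refine Finset.sum_le_sum fun i _ => ?_
        rw [PiLp.sub_apply, Real.norm_of_nonneg (by linarith [(hx i).1])]
        linarith [(hx i).2]
    _ = n * l := by simp

/-- Substitute `y = x + h`. Both points lie in the ball of radius `n l`, so `h` lies in a centred
ball of twice that radius; after Tonelli, Hölder in `x` passes from `L²` to `L^p`. -/
theorem lintegral_cube_le {n : ℕ} {F : Rn n → ℂ} (hF : Continuous F) {p : ℝ} (hp : 2 ≤ p) (e : ℝ)
    (a : Rn n) (l : ℝ) :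
    ∫⁻ x in cube a l, ∫⁻ y in cube a l, ‖F x - F y‖ₑ ^ (2 : ℝ) / ‖x - y‖ₑ ^ e ≤
      volume (Metric.closedBall a (n * l)) ^ (1 - 2 / p) *
        ∫⁻ h in Metric.closedBall (0 : Rn n) (2 * (n * l)),
          eLpNorm (fun x => F (x + h) - F x) (ENNReal.ofReal p) volume ^ (2 : ℝ) / ‖h‖ₑ ^ e := by
  have hp0 : 0 < p := by linarith
  set B := Metric.closedBall a (n * l) with hB
  set B₂ := Metric.closedBall (0 : Rn n) (2 * (n * l)) with hB₂
  have hsub : cube a l ⊆ B := cube_subset_closedBall a l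
  have hinner : ∀ x ∈ B, ∫⁻ y in cube a l, ‖F x - F y‖ₑ ^ (2 : ℝ) / ‖x - y‖ₑ ^ e ≤
      ∫⁻ h in B₂, ‖F (x + h) - F x‖ₑ ^ (2 : ℝ) / ‖h‖ₑ ^ e := by
    intro x hx
    refine (lintegral_mono_set hsub).trans ?_
    rw [← lintegral_indicator measurableSet_closedBall,
      ← lintegral_add_left_eq_self _ x, ← lintegral_indicator measurableSet_closedBall]
    refine lintegral_mono fun h => ?_
    by_cases hh : x + h ∈ B
    · have h2 : h ∈ B₂ := by
        rw [mem_closedBall_iff_norm] at hh hx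
        rw [mem_closedBall_zero_iff]
        calc ‖h‖ = ‖(x + h - a) - (x - a)‖ := by congr 1; abel
          _ ≤ ‖x + h - a‖ + ‖x - a‖ := norm_sub_le _ _
          _ ≤ _ := by linarith
      rw [Set.indicator_of_mem hh, Set.indicator_of_mem h2]
      have e1 : x - (x + h) = -h := by abel
      rw [e1, enorm_neg, ← enorm_neg, neg_sub]
    · rw [Set.indicator_of_notMem hh]; exact zero_le
  have hmeas : Measurable fun q : Rn n × Rn n => ‖F (q.1 + q.2) - F q.1‖ₑ ^ (2 : ℝ) / ‖q.2‖ₑ ^ e := by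
    have hc : Continuous fun q : Rn n × Rn n => F (q.1 + q.2) - F q.1 := by fun_prop
    exact (hc.enorm.measurable.pow_const _).div (measurable_snd.enorm.pow_const _)
  calc _ ≤ ∫⁻ x in B, ∫⁻ y in cube a l, ‖F x - F y‖ₑ ^ (2 : ℝ) / ‖x - y‖ₑ ^ e :=
        lintegral_mono_set hsub
    _ ≤ ∫⁻ x in B, ∫⁻ h in B₂, ‖F (x + h) - F x‖ₑ ^ (2 : ℝ) / ‖h‖ₑ ^ e :=
        setLIntegral_mono' measurableSet_closedBall hinner
    _ = ∫⁻ h in B₂, ∫⁻ x in B, ‖F (x + h) - F x‖ₑ ^ (2 : ℝ) / ‖h‖ₑ ^ e :=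
        lintegral_lintegral_swap hmeas.aemeasurable
    _ ≤ ∫⁻ h in B₂, volume B ^ (1 - 2 / p) *
          (eLpNorm (fun x => F (x + h) - F x) (ENNReal.ofReal p) volume ^ (2 : ℝ) / ‖h‖ₑ ^ e) := by
        refine lintegral_mono fun h => ?_
        have hc : Continuous fun x : Rn n => F (x + h) - F x := by fun_prop
        simp only [div_eq_mul_inv]
        rw [lintegral_mul_const _ (hc.enorm.measurable.pow_const _), ← mul_assoc]
        gcongr
        have h1 := eLpNorm_le_eLpNorm_mul_rpow_measure_univ (μ := volume.restrict B) (p := 2)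
          (q := ENNReal.ofReal p) (by
            rw [← ENNReal.ofReal_ofNat]; exact ENNReal.ofReal_le_ofReal hp)
          hc.aestronglyMeasurable
        rw [eLpNorm_eq_lintegral_rpow_enorm_toReal two_ne_zero ENNReal.ofNat_ne_top,
          Measure.restrict_apply_univ, ENNReal.toReal_ofReal hp0.le, ENNReal.toReal_ofNat,
          one_div, ENNReal.rpow_inv_le_iff two_pos,
          ENNReal.mul_rpow_of_nonneg _ _ zero_le_two, ← ENNReal.rpow_mul] at h1
        refine h1.trans ?_
        rw [mul_comm]
        have e2 : (2⁻¹ - 1 / p) * 2 = 1 - 2 / p := by ring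
        exact mul_le_mul' (by rw [e2, div_eq_mul_inv]) (ENNReal.rpow_le_rpow
          (eLpNorm_mono_measure _ Measure.restrict_le_self) zero_le_two)
    _ = _ := by
        rw [lintegral_const_mul']
        refine ENNReal.rpow_ne_top_of_nonneg ?_ measure_closedBall_lt_top.ne
        rw [sub_nonneg, div_le_one hp0]
        exact hp

theorem qNorm_lt_top {n : ℕ} (hn : 0 < n) {α β p γ M : ℝ} {F : Rn n → ℂ} (hF : Continuous F)
    (hp : 2 ≤ p) (hγ : n / p = γ - (2 - 2 * β))
    (h : ∀ ρ : ℝ, 0 < ρ → ∫⁻ h in Metric.closedBall (0 : Rn n) ρ,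
      eLpNorm (fun x => F (x + h) - F x) (ENNReal.ofReal p) volume ^ (2 : ℝ) /
        ‖h‖ₑ ^ (n + 2 * (α - β + 1)) ≤ ENNReal.ofReal (M * ρ ^ (2 * (γ - (α - β + 1))))) :
    qNorm α β F < ⊤ := by
  have hp0 : 0 < p := by linarith
  have hn' : (0 : ℝ) < n := by exact_mod_cast hn
  have hq : 0 ≤ 1 - 2 / p := by
    rw [sub_nonneg, div_le_one hp0]
    exact hp
  set v : ℝ := (volume (Metric.ball (0 : Rn n) 1)).toReal with hv
  have hv' : volume (Metric.ball (0 : Rn n) 1) = ENNReal.ofReal v :=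
    (ENNReal.ofReal_toReal measure_ball_lt_top.ne).symm
  have hv0 : 0 ≤ v := ENNReal.toReal_nonneg
  set T : ℝ := ((n : ℝ) ^ n * v) ^ (1 - 2 / p) * (M * (2 * n) ^ (2 * (γ - (α - β + 1)))) with hT
  refine lt_of_le_of_lt ?_ (ENNReal.rpow_lt_top_of_nonneg (y := 1 / 2) (by norm_num)
    (ENNReal.ofReal_ne_top (r := T)))
  refine iSup_le fun a => iSup_le fun l => iSup_le fun hl => ?_
  gcongr
  refine (mul_le_mul_right ((lintegral_cube_le hF hp _ a l).trans
    (mul_le_mul_right (h (2 * (n * l)) (by positivity)) _)) _).trans (le_of_eq ?_)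
  rw [Measure.addHaar_closedBall _ _ (by positivity), finrank_euclideanSpace_fin, hv',
    ← ENNReal.ofReal_mul (by positivity), ENNReal.ofReal_rpow_of_nonneg (by positivity) hq,
    ← ENNReal.ofReal_mul (by positivity), ← ENNReal.ofReal_mul (by positivity)]
  congr 1
  have e1 : ((n * l) ^ n * v) ^ (1 - 2 / p) = ((n : ℝ) ^ n * v) ^ (1 - 2 / p) *
      l ^ (n * (1 - 2 / p)) := by
    rw [mul_pow, mul_right_comm, Real.mul_rpow (by positivity) (by positivity),
      ← Real.rpow_natCast l n, ← Real.rpow_mul hl.le]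
  have e2 : (2 * (n * l)) ^ (2 * (γ - (α - β + 1))) =
      (2 * (n : ℝ)) ^ (2 * (γ - (α - β + 1))) * l ^ (2 * (γ - (α - β + 1))) := by
    rw [← mul_assoc, Real.mul_rpow (by positivity) hl.le]
  -- The norm is scale invariant: by `hγ` the exponents of `l` from the prefactor, the volume and
  -- the `h`-integral add up to zero.
  have e3 : l ^ (2 * (α + β - 1) - n) * l ^ (n * (1 - 2 / p)) * l ^ (2 * (γ - (α - β + 1))) = 1 := by
    rw [← Real.rpow_add hl, ← Real.rpow_add hl]
    have : 2 * (α + β - 1) - n + n * (1 - 2 / p) + 2 * (γ - (α - β + 1)) = 0 := by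
      have : n * (1 - 2 / p) = n - 2 * (n / p) := by ring
      rw [this, hγ]
      ring
    rw [this, Real.rpow_zero]
  rw [e1, e2, hT]
  linear_combination ((n : ℝ) ^ n * v) ^ (1 - 2 / p) * (M * (2 * n) ^ (2 * (γ - (α - β + 1)))) * e3

theorem enorm_rpow_eq_ofReal {n : ℕ} {h : Rn n} (hh : h ≠ 0) (e : ℝ) :
    (‖h‖ₑ ^ e)⁻¹ = ENNReal.ofReal (‖h‖ ^ (-e)) := by
  rw [← ENNReal.rpow_neg, ← ofReal_norm, ENNReal.ofReal_rpow_of_pos (norm_pos_iff.2 hh)]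

theorem ae_ne_zero {n : ℕ} (hn : 0 < n) (s : Set (Rn n)) :
    ∀ᵐ h ∂(volume.restrict s : Measure (Rn n)), h ≠ 0 := by
  have : Nonempty (Fin n) := ⟨⟨0, hn⟩⟩
  exact ae_restrict_of_ae (Measure.ae_ne volume 0)

/-- The bound of the increments when the dyadic coefficients are bounded. -/
theorem lintegral_increments_le_of_bounded {n : ℕ} (hn : 0 < n) {γ s C A : ℝ} (h0 : 0 < γ)
    (h1 : γ < 1) (hs : s < γ) (hC : 0 ≤ C) {b : ℤ → ℝ} (hb0 : ∀ j, 0 ≤ b j) (hbA : ∀ j, b j ≤ A)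
    {D : Rn n → ℝ≥0∞} (hD : ∀ h, D h ≤ ∑' j : ℤ, ENNReal.ofReal
      (C * min 1 ((2 : ℝ) ^ j * ‖h‖) * ((2 : ℝ) ^ (-(j * γ) : ℝ) * b j))) :
    ∃ M : ℝ, 0 ≤ M ∧ ∀ ρ : ℝ, 0 < ρ → ∫⁻ h in Metric.closedBall (0 : Rn n) ρ,
      D h ^ (2 : ℝ) / ‖h‖ₑ ^ (n + 2 * s) ≤ ENNReal.ofReal (M * ρ ^ (2 * (γ - s))) := by
  obtain ⟨K, hK, hsum⟩ := exists_tsum_dyadicKernel_le h0 h1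
  obtain ⟨c, hc, hball⟩ := lintegral_closedBall_rpow_le hn (show 0 < 2 * (γ - s) by linarith)
  have hA : 0 ≤ A := (hb0 0).trans (hbA 0)
  have hD' : ∀ h, h ≠ 0 → D h ≤ ENNReal.ofReal (C * A * K * ‖h‖ ^ γ) := by
    intro h hh
    have hh' : 0 < ‖h‖ := norm_pos_iff.2 hh
    obtain ⟨hsm, hle⟩ := hsum ‖h‖ hh'
    have hnn : ∀ j : ℤ, 0 ≤ dyadicKernel γ ((2 : ℝ) ^ j * ‖h‖) := fun j =>
      dyadicKernel_nonneg (by positivity)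
    refine (hD h).trans ?_
    calc _ ≤ ∑' j : ℤ, ENNReal.ofReal (C * A * ‖h‖ ^ γ * dyadicKernel γ ((2 : ℝ) ^ j * ‖h‖)) := by
          refine ENNReal.tsum_le_tsum fun j => ENNReal.ofReal_le_ofReal ?_
          calc _ = C * (min 1 ((2 : ℝ) ^ j * ‖h‖) * (2 : ℝ) ^ (-(j * γ) : ℝ)) * b j := by ring
            _ = C * (dyadicKernel γ ((2 : ℝ) ^ j * ‖h‖) * ‖h‖ ^ γ) * b j := by
              rw [min_mul_eq_dyadicKernel _ _ hh']
            _ ≤ C * (dyadicKernel γ ((2 : ℝ) ^ j * ‖h‖) * ‖h‖ ^ γ) * A := by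
              have := hnn j
              gcongr
              exact hbA j
            _ = _ := by ring
      _ = ENNReal.ofReal (C * A * ‖h‖ ^ γ * ∑' j : ℤ, dyadicKernel γ ((2 : ℝ) ^ j * ‖h‖)) := by
          rw [← tsum_mul_left, ENNReal.ofReal_tsum_of_nonneg _ (hsm.mul_left _)]
          exact fun j => mul_nonneg (by positivity) (hnn j)
      _ ≤ _ := by
          apply ENNReal.ofReal_le_ofReal
          calc _ ≤ C * A * ‖h‖ ^ γ * K := by gcongr
            _ = _ := by ring
  refine ⟨(C * A * K) ^ 2 * c, by positivity, fun ρ hρ => ?_⟩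
  -- The exponent `2(γ - s) - n` exceeds `-n`, by `s < γ`.
  calc _ ≤ ∫⁻ h in Metric.closedBall (0 : Rn n) ρ, ENNReal.ofReal ((C * A * K) ^ 2) *
          ENNReal.ofReal (‖h‖ ^ (2 * (γ - s) - n)) := by
        refine lintegral_mono_ae ?_
        filter_upwards [ae_ne_zero hn _] with h hh
        have hh' : 0 < ‖h‖ := norm_pos_iff.2 hh
        rw [div_eq_mul_inv, enorm_rpow_eq_ofReal hh]
        calc _ ≤ ENNReal.ofReal (C * A * K * ‖h‖ ^ γ) ^ (2 : ℝ) *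
              ENNReal.ofReal (‖h‖ ^ (-(n + 2 * s))) := by gcongr; exact hD' h hh
          _ = _ := by
            rw [ENNReal.ofReal_rpow_of_nonneg (by positivity) zero_le_two,
              ← ENNReal.ofReal_mul (by positivity), ← ENNReal.ofReal_mul (by positivity),
              Real.mul_rpow (by positivity) (by positivity), ← Real.rpow_mul hh'.le, mul_assoc,
              ← Real.rpow_add hh', Real.rpow_two]
            congr 3
            ring
    _ = ENNReal.ofReal ((C * A * K) ^ 2) * ∫⁻ h in Metric.closedBall (0 : Rn n) ρ,
          ENNReal.ofReal (‖h‖ ^ (2 * (γ - s) - n)) := lintegral_const_mul' _ _ ENNReal.ofReal_ne_top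
    _ ≤ ENNReal.ofReal ((C * A * K) ^ 2) * ENNReal.ofReal (c * ρ ^ (2 * (γ - s))) := by
        gcongr; exact hball ρ hρ
    _ = _ := by rw [← ENNReal.ofReal_mul (by positivity), mul_assoc (_ ^ 2)]

/-- The bound of the increments when the dyadic coefficients are square summable. -/
theorem lintegral_increments_le_of_square_summable {n : ℕ} (hn : 0 < n) {γ C : ℝ} (h0 : 0 < γ)
    (h1 : γ < 1) (hC : 0 ≤ C) {b : ℤ → ℝ}
    (hb : ∑' j, ENNReal.ofReal (b j) ^ (2 : ℝ) ≠ ⊤)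
    {D : Rn n → ℝ≥0∞} (hD : ∀ h, D h ≤ ∑' j : ℤ, ENNReal.ofReal
      (C * min 1 ((2 : ℝ) ^ j * ‖h‖) * ((2 : ℝ) ^ (-(j * γ) : ℝ) * b j))) :
    ∃ M : ℝ, 0 ≤ M ∧ ∀ ρ : ℝ, 0 < ρ → ∫⁻ h in Metric.closedBall (0 : Rn n) ρ,
      D h ^ (2 : ℝ) / ‖h‖ₑ ^ (n + 2 * γ) ≤ ENNReal.ofReal (M * ρ ^ (2 * (γ - γ))) := by
  obtain ⟨K, hK, hsum⟩ := exists_tsum_dyadicKernel_le h0 h1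
  obtain ⟨c, hc, hker⟩ := lintegral_dyadicKernel_le hn h0 h1
  set k : ℤ → Rn n → ℝ≥0∞ := fun j h => ENNReal.ofReal (dyadicKernel γ ((2 : ℝ) ^ j * ‖h‖)) with hk
  -- Only one of the two copies of the kernel is summed away; the other stays attached to `b j ^ 2`,
  -- to be integrated in `h` uniformly in `j`.
  have hD' : ∀ h, h ≠ 0 → D h ^ (2 : ℝ) ≤ ENNReal.ofReal (C ^ 2 * K * ‖h‖ ^ (2 * γ)) *
      ∑' j, k j h * ENNReal.ofReal (b j) ^ (2 : ℝ) := by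
    intro h hh
    have hh' : 0 < ‖h‖ := norm_pos_iff.2 hh
    obtain ⟨hsm, hle⟩ := hsum ‖h‖ hh'
    have hnn : ∀ j : ℤ, 0 ≤ dyadicKernel γ ((2 : ℝ) ^ j * ‖h‖) := fun j =>
      dyadicKernel_nonneg (by positivity)
    have h3 : D h ≤ ENNReal.ofReal (C * ‖h‖ ^ γ) * ∑' j, k j h * ENNReal.ofReal (b j) := by
      refine (hD h).trans (le_of_eq ?_)
      rw [← ENNReal.tsum_mul_left]
      congr 1
      ext j
      rw [hk, ← ENNReal.ofReal_mul (hnn j), ← ENNReal.ofReal_mul (by positivity)]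
      congr 1
      calc _ = C * (min 1 ((2 : ℝ) ^ j * ‖h‖) * (2 : ℝ) ^ (-(j * γ) : ℝ)) * b j := by ring
        _ = C * (dyadicKernel γ ((2 : ℝ) ^ j * ‖h‖) * ‖h‖ ^ γ) * b j := by
          rw [min_mul_eq_dyadicKernel _ _ hh']
        _ = _ := by ring
    have h4 : ∑' j, k j h ≤ ENNReal.ofReal K := by
      rw [hk, ← ENNReal.ofReal_tsum_of_nonneg hnn hsm]
      exact ENNReal.ofReal_le_ofReal hle
    calc D h ^ (2 : ℝ) ≤ (ENNReal.ofReal (C * ‖h‖ ^ γ) *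
          ∑' j, k j h * ENNReal.ofReal (b j)) ^ (2 : ℝ) := by gcongr
      _ = ENNReal.ofReal (C * ‖h‖ ^ γ) ^ (2 : ℝ) *
          (∑' j, k j h * ENNReal.ofReal (b j)) ^ (2 : ℝ) :=
          ENNReal.mul_rpow_of_nonneg _ _ zero_le_two
      _ ≤ ENNReal.ofReal (C * ‖h‖ ^ γ) ^ (2 : ℝ) *
          (ENNReal.ofReal K * ∑' j, k j h * ENNReal.ofReal (b j) ^ (2 : ℝ)) := by
          gcongr
          exact (ENNReal.tsum_mul_sq_le _ _).trans (by gcongr)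
      _ = _ := by
          rw [← mul_assoc, ENNReal.ofReal_rpow_of_nonneg (by positivity) zero_le_two,
            ← ENNReal.ofReal_mul (by positivity), Real.mul_rpow hC (by positivity),
            ← Real.rpow_mul hh'.le, Real.rpow_two]
          congr 2
          ring_nf
  set S : ℝ := (∑' j, ENNReal.ofReal (b j) ^ (2 : ℝ)).toReal with hS
  have hS' : ∑' j, ENNReal.ofReal (b j) ^ (2 : ℝ) = ENNReal.ofReal S :=
    (ENNReal.ofReal_toReal hb).symm
  have hS0 : 0 ≤ S := ENNReal.toReal_nonneg
  refine ⟨C ^ 2 * K * (c * S), by positivity, fun ρ hρ => ?_⟩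
  have hkm : ∀ j, Measurable (k j) := by
    intro j
    simp only [hk, dyadicKernel]
    fun_prop
  calc _ ≤ ∫⁻ h in Metric.closedBall (0 : Rn n) ρ, ENNReal.ofReal (C ^ 2 * K) *
          ∑' j, ENNReal.ofReal (‖h‖ ^ (-(n : ℝ)) * dyadicKernel γ ((2 : ℝ) ^ j * ‖h‖)) *
            ENNReal.ofReal (b j) ^ (2 : ℝ) := by
        refine lintegral_mono_ae ?_
        filter_upwards [ae_ne_zero hn _] with h hh
        have hh' : 0 < ‖h‖ := norm_pos_iff.2 hh
        rw [div_eq_mul_inv, enorm_rpow_eq_ofReal hh]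
        refine (mul_le_mul_left (hD' h hh) _).trans (le_of_eq ?_)
        have e : ‖h‖ ^ (2 * γ) * ‖h‖ ^ (-(n + 2 * γ)) = ‖h‖ ^ (-(n : ℝ)) := by
          rw [← Real.rpow_add hh']; congr 1; ring
        simp only [ENNReal.ofReal_mul (show 0 ≤ ‖h‖ ^ (-(n : ℝ)) by positivity), mul_assoc,
          ENNReal.tsum_mul_left]
        rw [← e, ENNReal.ofReal_mul (p := ‖h‖ ^ (2 * γ)) (by positivity), ENNReal.ofReal_mul
          (p := C ^ 2) (by positivity), ENNReal.ofReal_mul (p := C ^ 2) (by positivity),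
          ENNReal.ofReal_mul hK]
        ring
    -- The kernel is integrable over the whole space, so the ball is dropped; this matches the
    -- exponent zero of `ρ`.
    _ ≤ ∫⁻ h : Rn n, ENNReal.ofReal (C ^ 2 * K) *
          ∑' j, ENNReal.ofReal (‖h‖ ^ (-(n : ℝ)) * dyadicKernel γ ((2 : ℝ) ^ j * ‖h‖)) *
            ENNReal.ofReal (b j) ^ (2 : ℝ) := setLIntegral_le_lintegral _ _
    _ = ENNReal.ofReal (C ^ 2 * K) * ∑' j, (∫⁻ h : Rn n,
          ENNReal.ofReal (‖h‖ ^ (-(n : ℝ)) * dyadicKernel γ ((2 : ℝ) ^ j * ‖h‖))) *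
            ENNReal.ofReal (b j) ^ (2 : ℝ) := by
        have hm : ∀ j : ℤ, Measurable fun h : Rn n =>
            ENNReal.ofReal (‖h‖ ^ (-(n : ℝ)) * dyadicKernel γ ((2 : ℝ) ^ j * ‖h‖)) := by
          intro j
          simp only [dyadicKernel]
          fun_prop
        rw [lintegral_const_mul' _ _ ENNReal.ofReal_ne_top,
          lintegral_tsum fun j => ((hm j).mul_const _).aemeasurable]
        congr 2
        ext j
        rw [lintegral_mul_const _ (hm j)]
    _ ≤ ENNReal.ofReal (C ^ 2 * K) * ∑' j, ENNReal.ofReal c * ENNReal.ofReal (b j) ^ (2 : ℝ) := by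
        gcongr with j
        exact hker j
    _ = _ := by
        rw [ENNReal.tsum_mul_left, hS', ← ENNReal.ofReal_mul hc, ← ENNReal.ofReal_mul (by positivity),
          sub_self, mul_zero, Real.rpow_zero, mul_one]

/-! ### From Besov spaces to `Q_α^β` -/

theorem mem_qClasses_of_lpPiece {n : ℕ} (hn : 0 < n) (φ₀ : AnnulusBump n) {α β p γ A : ℝ}
    (hβ : 1 / 2 < β) (hβ1 : β < 1) (hp : 2 ≤ p) (hγ : n / p = γ - (2 - 2 * β)) (h0 : 0 < γ)
    (h1 : γ < 1) {f : SchwartzZeroDual n}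
    (hN : ∀ j, eLpNorm (lpPiece φ₀ j f) (ENNReal.ofReal p) volume ≠ ⊤)
    (hA : ∀ j : ℤ, (2 : ℝ) ^ (j * γ : ℝ) *
      (eLpNorm (lpPiece φ₀ j f) (ENNReal.ofReal p) volume).toReal ≤ A)
    (hs : α - β + 1 < γ ∨ α - β + 1 = γ ∧ ∑' j : ℤ, ENNReal.ofReal ((2 : ℝ) ^ (j * γ : ℝ) *
      (eLpNorm (lpPiece φ₀ j f) (ENNReal.ofReal p) volume).toReal) ^ (2 : ℝ) ≠ ⊤) :
    f ∈ qClasses n α β := by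
  obtain ⟨θ, hθ⟩ := exists_schwartz_fourier_eq_one n
  obtain ⟨C, hC, hbern⟩ := exists_bernstein_const θ (show 1 ≤ p by linarith)
  set g : ℤ → Rn n → ℂ := fun j => lpPiece φ₀ j f with hg
  set N : ℤ → ℝ := fun j => (eLpNorm (g j) (ENNReal.ofReal p) volume).toReal with hNdef
  set b : ℤ → ℝ := fun j => (2 : ℝ) ^ (j * γ : ℝ) * N j with hb
  have hb0 : ∀ j, 0 ≤ b j := fun j => mul_nonneg (by positivity) ENNReal.toReal_nonneg
  have hc : ∀ j, Continuous (g j) := fun j => continuous_lpPiece φ₀ j f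
  have hσ0 : 0 < 2 - 2 * β := by linarith
  have hσ1 : 2 - 2 * β < 1 := by linarith
  have hH := fun j => hbern j (g j) (hc j) (hN j) (integral_dilate_mul_lpPiece φ₀ j f hθ)
  -- By `hγ`, the Bernstein factor `2^{jn/p}` equals `2^{-j(2-2β)} 2^{jγ}`; hence the Hölder
  -- exponent `2 - 2β`.
  have h2 : ∀ j x h, ‖g j (x + h) - g j x‖ ≤
      C * min 1 ((2 : ℝ) ^ j * ‖h‖) * ((2 : ℝ) ^ (-(j * (2 - 2 * β)) : ℝ) * b j) := by
    intro j x h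
    refine ((hH j).2.1 x h).trans_eq ?_
    rw [hb, ← mul_assoc ((2 : ℝ) ^ (-(j * (2 - 2 * β)) : ℝ)), ← Real.rpow_add two_pos, hγ]
    congr 3
    ring
  have h3 : ∀ j h, eLpNorm (fun x => g j (x + h) - g j x) (ENNReal.ofReal p) volume ≤
      ENNReal.ofReal (C * min 1 ((2 : ℝ) ^ j * ‖h‖) * ((2 : ℝ) ^ (-(j * γ) : ℝ) * b j)) := by
    intro j h
    refine ((hH j).2.2 h).trans_eq ?_
    rw [hb, ← mul_assoc ((2 : ℝ) ^ (-(j * γ) : ℝ)), ← Real.rpow_add two_pos, neg_add_cancel,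
      Real.rpow_zero, one_mul]
  obtain ⟨M, -, hM⟩ := exists_tsum_increment_le hC hb0 hA hσ0 hσ1 h2
  have hF := continuous_pieceSum hσ0 hM
  have hD : ∀ h, eLpNorm (fun x => pieceSum g (x + h) - pieceSum g x) (ENNReal.ofReal p) volume ≤
      ∑' j : ℤ, ENNReal.ofReal (C * min 1 ((2 : ℝ) ^ j * ‖h‖) *
        ((2 : ℝ) ^ (-(j * γ) : ℝ) * b j)) := fun h =>
    (eLpNorm_pieceSum_sub_le (ENNReal.one_le_ofReal.2 (by linarith)) hM hc h).trans
      (ENNReal.tsum_le_tsum fun j => h3 j h)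
  refine ⟨pieceSum g, ⟨hF.aestronglyMeasurable, ?_⟩, ?_⟩
  · have key : ∃ M : ℝ, 0 ≤ M ∧ ∀ ρ : ℝ, 0 < ρ → ∫⁻ h in Metric.closedBall (0 : Rn n) ρ,
        eLpNorm (fun x => pieceSum g (x + h) - pieceSum g x) (ENNReal.ofReal p) volume ^ (2 : ℝ) /
        ‖h‖ₑ ^ (n + 2 * (α - β + 1)) ≤ ENNReal.ofReal (M * ρ ^ (2 * (γ - (α - β + 1)))) := by
      rcases hs with hs | ⟨hs, hsum⟩
      · exact lintegral_increments_le_of_bounded hn h0 h1 hs hC hb0 hA hD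
      · rw [hs]
        exact lintegral_increments_le_of_square_summable hn h0 h1 hC hsum hD
    obtain ⟨M', hM', hle⟩ := key
    exact qNorm_lt_top hn hF hp hγ hle
  · exact isRepresentative_pieceSum hσ0 hσ1 hM hc (fun j => ⟨_, (hH j).1⟩)
      (f.hasSum_integral_lpPiece φ₀)

/-! ### Consequences of a finite Besov norm -/

theorem le_besovNorm {n : ℕ} (φ₀ : AnnulusBump n) (s : ℝ) (p : ℝ≥0∞) {q : ℝ≥0∞} (hq : 1 ≤ q)
    (f : SchwartzZeroDual n) (j : ℤ) :
    ENNReal.ofReal ((2 : ℝ) ^ (j * s : ℝ)) * eLpNorm (lpPiece φ₀ j f) p volume ≤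
      besovNorm φ₀ s p q f := by
  rw [besovNorm]
  split_ifs with h
  · exact le_iSup (fun j : ℤ => ENNReal.ofReal ((2 : ℝ) ^ (j * s : ℝ)) *
      eLpNorm (lpPiece φ₀ j f) p volume) j
  · have hq0 : 0 < q.toReal := ENNReal.toReal_pos (zero_lt_one.trans_le hq).ne' h
    rw [one_div, ENNReal.le_rpow_inv_iff hq0]
    exact ENNReal.le_tsum (f := fun j : ℤ => (ENNReal.ofReal ((2 : ℝ) ^ (j * s : ℝ)) *
      eLpNorm (lpPiece φ₀ j f) p volume) ^ q.toReal) j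

theorem eLpNorm_lpPiece_ne_top {n : ℕ} {φ₀ : AnnulusBump n} {s : ℝ} {p q : ℝ≥0∞} (hq : 1 ≤ q)
    {f : SchwartzZeroDual n} (hf : f ∈ besovSpace φ₀ s p q) (j : ℤ) :
    eLpNorm (lpPiece φ₀ j f) p volume ≠ ⊤ := by
  intro h
  have := (le_besovNorm φ₀ s p hq f j).trans_lt hf
  rw [h, ENNReal.mul_top (by simpa using Real.rpow_pos_of_pos two_pos _)] at this
  exact lt_irrefl _ this

theorem rpow_mul_toReal_eLpNorm_lpPiece_le {n : ℕ} {φ₀ : AnnulusBump n} {s : ℝ} {p q : ℝ≥0∞}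
    (hq : 1 ≤ q) {f : SchwartzZeroDual n} (hf : f ∈ besovSpace φ₀ s p q) (j : ℤ) :
    (2 : ℝ) ^ (j * s : ℝ) * (eLpNorm (lpPiece φ₀ j f) p volume).toReal ≤
      (besovNorm φ₀ s p q f).toReal := by
  have := ENNReal.toReal_mono hf.ne (le_besovNorm φ₀ s p hq f j)
  rwa [ENNReal.toReal_mul, ENNReal.toReal_ofReal (by positivity)] at this

/-- The inclusion of `ℓ^q` in `ℓ²`: each term is at most the Besov norm `B`, so its square is at
most `B^{2-q}` times its `q`-th power. -/
theorem tsum_sq_lpPiece_ne_top {n : ℕ} {φ₀ : AnnulusBump n} {s : ℝ} {p q : ℝ≥0∞}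
    (hq : 1 ≤ q) (hq2 : q ≤ 2) {f : SchwartzZeroDual n} (hf : f ∈ besovSpace φ₀ s p q) :
    ∑' j : ℤ, ENNReal.ofReal ((2 : ℝ) ^ (j * s : ℝ) *
      (eLpNorm (lpPiece φ₀ j f) p volume).toReal) ^ (2 : ℝ) ≠ ⊤ := by
  have hqt : q ≠ ⊤ := ne_top_of_le_ne_top ENNReal.ofNat_ne_top hq2
  have hq0 : 0 < q.toReal := ENNReal.toReal_pos (zero_lt_one.trans_le hq).ne' hqt
  have hq2' : q.toReal ≤ 2 := by simpa using ENNReal.toReal_mono ENNReal.ofNat_ne_top hq2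
  have hf' : besovNorm φ₀ s p q f < ⊤ := hf
  have hle := le_besovNorm φ₀ s p hq f
  set B := besovNorm φ₀ s p q f with hB
  rw [besovNorm, if_neg hqt] at hB
  have hsum : ∑' j : ℤ, (ENNReal.ofReal ((2 : ℝ) ^ (j * s : ℝ)) *
      eLpNorm (lpPiece φ₀ j f) p volume) ^ q.toReal ≠ ⊤ := by
    intro h
    rw [h, ENNReal.top_rpow_of_pos (by positivity)] at hB
    exact hf'.ne hB
  refine ((?_ : _ ≤ B ^ (2 - q.toReal) * ∑' j : ℤ, (ENNReal.ofReal ((2 : ℝ) ^ (j * s : ℝ)) *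
      eLpNorm (lpPiece φ₀ j f) p volume) ^ q.toReal).trans_lt (ENNReal.mul_lt_top
      (ENNReal.rpow_lt_top_of_nonneg (by linarith) hf'.ne) hsum.lt_top)).ne
  rw [← ENNReal.tsum_mul_left]
  refine ENNReal.tsum_le_tsum fun j => ?_
  rw [ENNReal.ofReal_mul (by positivity), ENNReal.ofReal_toReal (eLpNorm_lpPiece_ne_top hq hf j)]
  calc _ = (ENNReal.ofReal ((2 : ℝ) ^ (j * s : ℝ)) *
        eLpNorm (lpPiece φ₀ j f) p volume) ^ ((2 - q.toReal) + q.toReal) := by rw [sub_add_cancel]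
    _ = _ := ENNReal.rpow_add_of_nonneg _ _ (by linarith) hq0.le
    _ ≤ _ := by
      gcongr
      exact hle j

/-- Interpolation between `L^{p₀}` and `L^∞`. -/
theorem eLpNorm_le_of_norm_le {n : ℕ} {g : Rn n → ℂ} (hg : Continuous g) {S p p₀ : ℝ}
    (hp₀ : 0 < p₀) (hp : p₀ ≤ p) (hS : ∀ x, ‖g x‖ ≤ S) :
    eLpNorm g (ENNReal.ofReal p) volume ≤
      ENNReal.ofReal S ^ (1 - p₀ / p) * eLpNorm g (ENNReal.ofReal p₀) volume ^ (p₀ / p) := by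
  have hp0 : 0 < p := hp₀.trans_le hp
  rw [eLpNorm_eq_lintegral_rpow_enorm_toReal (by simpa using hp0) ENNReal.ofReal_ne_top,
    eLpNorm_eq_lintegral_rpow_enorm_toReal (by simpa using hp₀) ENNReal.ofReal_ne_top,
    ENNReal.toReal_ofReal hp0.le, ENNReal.toReal_ofReal hp₀.le]
  have h : ∫⁻ x, ‖g x‖ₑ ^ p ≤ ENNReal.ofReal S ^ (p - p₀) * ∫⁻ x, ‖g x‖ₑ ^ p₀ := by
    rw [← lintegral_const_mul _ (hg.enorm.measurable.pow_const p₀)]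
    refine lintegral_mono fun x => ?_
    calc ‖g x‖ₑ ^ p = ‖g x‖ₑ ^ ((p - p₀) + p₀) := by rw [sub_add_cancel]
      _ = ‖g x‖ₑ ^ (p - p₀) * ‖g x‖ₑ ^ p₀ :=
        ENNReal.rpow_add_of_nonneg _ _ (by linarith) hp₀.le
      _ ≤ _ := by
        gcongr
        rw [← ofReal_norm]
        exact ENNReal.ofReal_le_ofReal (hS x)
  calc _ ≤ (ENNReal.ofReal S ^ (p - p₀) * ∫⁻ x, ‖g x‖ₑ ^ p₀) ^ (1 / p) := by gcongr
    _ = _ := by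
      rw [ENNReal.mul_rpow_of_nonneg _ _ (by positivity), ← ENNReal.rpow_mul, ← ENNReal.rpow_mul]
      congr 2 <;> field_simp

/-- The Bernstein inequality between the `L^p` norms of Littlewood–Paley pieces. -/
theorem exists_eLpNorm_lpPiece_le {n : ℕ} (φ₀ : AnnulusBump n) {p p₀ : ℝ} (hp₀ : 1 ≤ p₀)
    (hp : p₀ ≤ p) : ∃ C : ℝ, 0 ≤ C ∧ ∀ (j : ℤ) (f : SchwartzZeroDual n),
      eLpNorm (lpPiece φ₀ j f) (ENNReal.ofReal p₀) volume ≠ ⊤ →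
      eLpNorm (lpPiece φ₀ j f) (ENNReal.ofReal p) volume ≤
        ENNReal.ofReal (C * (2 : ℝ) ^ (j * (n / p₀ - n / p) : ℝ) *
          (eLpNorm (lpPiece φ₀ j f) (ENNReal.ofReal p₀) volume).toReal) := by
  obtain ⟨θ, hθ⟩ := exists_schwartz_fourier_eq_one n
  obtain ⟨C, hC, hbern⟩ := exists_bernstein_const θ hp₀
  have hp₀' : 0 < p₀ := by linarith
  have hp0 : 0 < p := by linarith
  have hr : 0 ≤ 1 - p₀ / p := by rw [sub_nonneg, div_le_one hp0]; exact hp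
  refine ⟨C ^ (1 - p₀ / p), by positivity, fun j f hN => ?_⟩
  have hc := continuous_lpPiece φ₀ j f
  have hH := (hbern j _ hc hN (integral_dilate_mul_lpPiece φ₀ j f hθ)).1
  refine (eLpNorm_le_of_norm_le hc hp₀' hp hH).trans (le_of_eq ?_)
  set N := (eLpNorm (lpPiece φ₀ j f) (ENNReal.ofReal p₀) volume).toReal with hNdef
  have hN0 : 0 ≤ N := ENNReal.toReal_nonneg
  have hNe : eLpNorm (lpPiece φ₀ j f) (ENNReal.ofReal p₀) volume = ENNReal.ofReal N :=
    (ENNReal.ofReal_toReal hN).symm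
  rw [hNe, ENNReal.ofReal_rpow_of_nonneg (by positivity) hr,
    ENNReal.ofReal_rpow_of_nonneg hN0 (by positivity), ← ENNReal.ofReal_mul (by positivity),
    Real.mul_rpow (by positivity) hN0, Real.mul_rpow hC (by positivity),
    ← Real.rpow_mul zero_le_two, mul_assoc _ (N ^ _), ← Real.rpow_add_of_nonneg hN0 hr
    (by positivity), sub_add_cancel, Real.rpow_one]
  congr 4
  field_simp

theorem theorem3p3 (n : ℕ) (hn : 2 ≤ n) (φ₀ : AnnulusBump n) (α β : ℝ)
    (hβ : max (1 / 2) α < β) (hβ1 : β < 1) :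
    (∀ q : ℝ≥0∞, 1 ≤ q → q ≤ 2 → 0 < α + β - 1 →
      besovSpace φ₀ (α - β + 1) (ENNReal.ofReal (n / (α + β - 1))) q ⊆ qClasses n α β) ∧
    (∀ q : ℝ≥0∞, 1 ≤ q → ∀ γ₁ γ₂ : ℝ, α - β + 1 < γ₁ → 0 < γ₂ → γ₂ ≤ n →
      γ₁ - γ₂ = 2 - 2 * β →
      besovSpace φ₀ γ₁ (ENNReal.ofReal (n / γ₂)) q ⊆ qClasses n α β) := by
  obtain ⟨hβ2, hαβ⟩ := max_lt_iff.1 hβ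
  have hn0 : 0 < n := by omega
  have hn' : (2 : ℝ) ≤ n := by exact_mod_cast hn
  have hnpos : (0 : ℝ) < n := by linarith
  constructor
  · intro q hq hq2 hpos f hf
    -- The critical case `γ = s`. Here `n / p = α + β - 1 < 1`, so `p ≥ 2` follows from `n ≥ 2`.
    refine mem_qClasses_of_lpPiece hn0 φ₀ (p := n / (α + β - 1)) (γ := α - β + 1) hβ2 hβ1 ?_ ?_
      (by linarith) (by linarith) (eLpNorm_lpPiece_ne_top hq hf)
      (rpow_mul_toReal_eLpNorm_lpPiece_le hq hf) (Or.inr ⟨rfl, tsum_sq_lpPiece_ne_top hq hq2 hf⟩)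
    · rw [le_div_iff₀ hpos]; nlinarith
    · rw [div_div_cancel₀ hnpos.ne']; ring
  · intro q hq γ₁ γ₂ hγ₁ hγ₂ hγ₂n hγ f hf
    -- The interval is nonempty because `α < β`, `β > 1/2` and `γ₂ > 0`. The lower bounds make the
    -- increments square integrable and `p` finite; `γ < 1` serves the dyadic sums and `γ < γ₁` lets
    -- Bernstein raise the exponent.
    obtain ⟨γ, hγl, hγu⟩ := exists_between (show max (α - β + 1) (2 - 2 * β) < min 1 γ₁ from
      max_lt (lt_min (by linarith) hγ₁) (lt_min (by linarith) (by linarith)))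
    obtain ⟨hγs, hγσ⟩ := max_lt_iff.1 hγl
    obtain ⟨hγ1, hγγ₁⟩ := lt_min_iff.1 hγu
    have hr : 0 < γ - (2 - 2 * β) := by linarith
    have hp₀ : 1 ≤ n / γ₂ := by rwa [one_le_div hγ₂]
    have hp : n / γ₂ ≤ n / (γ - (2 - 2 * β)) := by gcongr; linarith
    obtain ⟨C, hC, hle⟩ := exists_eLpNorm_lpPiece_le φ₀ hp₀ hp
    have hN₀ := eLpNorm_lpPiece_ne_top hq hf
    refine mem_qClasses_of_lpPiece hn0 φ₀ (p := n / (γ - (2 - 2 * β))) (γ := γ)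
      (A := C * (besovNorm φ₀ γ₁ (ENNReal.ofReal (n / γ₂)) q f).toReal) hβ2 hβ1 ?_ ?_
      (by linarith) hγ1 (fun j => ((hle j f (hN₀ j)).trans_lt ENNReal.ofReal_lt_top).ne)
      (fun j => ?_) (Or.inl hγs)
    · rw [le_div_iff₀ hr]; nlinarith
    · rw [div_div_cancel₀ hnpos.ne']
    · have h1 := rpow_mul_toReal_eLpNorm_lpPiece_le hq hf j
      have h2 := ENNReal.toReal_mono ENNReal.ofReal_ne_top (hle j f (hN₀ j))
      rw [ENNReal.toReal_ofReal (by positivity), div_div_cancel₀ hnpos.ne',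
        div_div_cancel₀ hnpos.ne'] at h2
      calc _ ≤ (2 : ℝ) ^ (j * γ : ℝ) * (C * (2 : ℝ) ^ (j * (γ₂ - (γ - (2 - 2 * β))) : ℝ) *
            (eLpNorm (lpPiece φ₀ j f) (ENNReal.ofReal (n / γ₂)) volume).toReal) := by gcongr
        _ = C * ((2 : ℝ) ^ (j * γ₁ : ℝ) *
            (eLpNorm (lpPiece φ₀ j f) (ENNReal.ofReal (n / γ₂)) volume).toReal) := by
          -- Bernstein costs exactly `γ₁ - γ` derivatives, since `γ₁ - γ₂ = 2 - 2β`.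
          have : (2 : ℝ) ^ (j * γ₁ : ℝ) =
              (2 : ℝ) ^ (j * γ : ℝ) * (2 : ℝ) ^ (j * (γ₂ - (γ - (2 - 2 * β))) : ℝ) := by
            rw [← Real.rpow_add two_pos, ← mul_add]
            congr 2
            linarith
          rw [this]
          ring
        _ ≤ _ := by gcongr
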